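/- Let $\mathcal C$ be a model category and let $S$ be a class of maps of $\mathcal C$. For a functor $X:\Delta\to\mathcal C$ and a simplicial set $K$ write $X\otimes K=\operatorname{colim}_{\Delta^m\to K}X^m$, the colimit over the category of simplices of $K$ (so $X\otimes\Delta^n\cong X^n$, and $X\otimes\partial\Delta^n$ is the latching object $L_nX$). A cosimplicial resolution of an object $A$ is a Reedy cofibrant $X:\Delta\to\mathcal C$ together with a levelwise weak equivalence from $X$ to the constant functor on $A$. A cofibrant cosimplicial resolution of a map $f:A\to B$ consists of cosimplicial resolutions $X$ of $A$ and $Y$ of $B$ and a Reedy cofibration $X\to Y$ compatible with $f$. A class of horns on $S$ is a class $\Lambda(S)$ consisting, up to isomorphism of arrows, of the maps $$ (X\otimes\Delta^n)\amalg_{X\otimes\partial\Delta^n}(Y\otimes\partial\Delta^n)\longrightarrow Y\otimes\Delta^n\qquad(n\ge 0), $$ where $X\to Y$ runs over a chosen nonempty collection of cofibrant cosimplicial resolutions (for instance, a single one) of each map in $S$. A class $T$ of maps of $\mathcal C$ is closed under coidentity types if for every object $\Gamma$ and every map $i:U\to V$ of $\mathcal C/\Gamma$ whose underlying map belongs to $T$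 there are cylinder objects $U\amalg U\to C(U)\to U$ and $V\amalg V\to C(V)\to V$ in $\mathcal C/\Gamma$ (factorizations of the fold maps into a cofibration followed by a weak equivalence) and a map $C(U)\to C(V)$ over $i$, compatible with these factorizations, such that the induced map $$ C(U)\amalg_{U\amalg U}(V\amalg V)\longrightarrow C(V) $$ has the left lifting property in $\mathcal C/\Gamma$ with respect to every fibrant object $E\to\Gamma$ of $\mathcal C/\Gamma$ which, as a map of $\mathcal C$, has the right lifting property with respect to $T$. Then every class of horns $\Lambda(S)$ on $S$ is closed under coidentity types, and every map in $\Lambda(S)$ is a cofibration between cofibrant objects. -/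

import Mathlib

open CategoryTheory Limits HomotopicalAlgebra Simplicial

universe v u

namespace CosimplicialResolutions

/-! ### Latching objects and the Reedy structure on cosimplicial objects -/

/-- The latching category of `⦋n⦌`: the full subcategory of `Over ⦋n⦌` on the injective maps
`⦋k⦌ ⟶ ⦋n⦌` other than the identity. -/
abbrev LatchingCategory (n : ℕ) : Type :=
  ObjectProperty.FullSubcategory (fun f : Over ⦋n⦌ => Mono f.hom ∧ ¬ IsIso f.hom)

instance finite_hom (a b : SimplexCategory) : Finite (a ⟶ b) :=
  Finite.of_injective (fun f => (f.toOrderHom : Fin (a.len + 1) → Fin (b.len + 1))) (by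
    intro f g h
    ext i
    exact congrArg Fin.val (congrFun h i))

instance finite_latchingCategory (n : ℕ) : Finite (LatchingCategory n) := by
  let φ : (Σ k : Fin (n + 1), {f : ⦋(k : ℕ)⦌ ⟶ ⦋n⦌ // Mono f ∧ ¬ IsIso f}) → LatchingCategory n :=
    fun x => ⟨Over.mk x.2.1, x.2.2⟩
  refine Finite.of_surjective φ ?_
  rintro ⟨⟨a, ⟨⟨⟩⟩, f⟩, hf⟩
  have : Mono f := hf.1
  exact ⟨⟨⟨a.len, Nat.lt_succ_of_le (SimplexCategory.len_le_of_mono f)⟩, ⟨f, hf⟩⟩, rfl⟩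

instance finite_latchingCategory_hom (n : ℕ) (a b : LatchingCategory n) : Finite (a ⟶ b) :=
  Finite.of_injective (fun f => f.hom.left) (by
    intro f g h
    ext1
    ext1
    exact h)

variable {C : Type u} [Category.{v} C]

instance hasColimitsOfShape_latchingCategory [HasFiniteColimits C] (n : ℕ) :
    HasColimitsOfShape (LatchingCategory n) C := by
  let _ : FinCategory (LatchingCategory n) :=
    { fintypeObj := Fintype.ofFinite _
      fintypeHom := fun _ _ => Fintype.ofFinite _ }
  infer_instance

/-- The diagram `(⦋k⦌ ↪ ⦋n⦌) ↦ X ⦋k⦌` on the latching category. -/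
@[simps]
def latchingDiagram (X : SimplexCategory ⥤ C) (n : ℕ) : LatchingCategory n ⥤ C where
  obj f := X.obj f.obj.left
  map φ := X.map φ.hom.left

section Reedy

variable [HasFiniteColimits C]

/-- The latching object `L_n X`. -/
noncomputable def latchingObj (X : SimplexCategory ⥤ C) (n : ℕ) : C :=
  colimit (latchingDiagram X n)

/-- The canonical map `X ⦋k⦌ ⟶ L_n X` for an object `⦋k⦌ ↪ ⦋n⦌` of the latching category. -/
noncomputable def latchingι (X : SimplexCategory ⥤ C) (n : ℕ) (f : LatchingCategory n) :
    X.obj f.obj.left ⟶ latchingObj X n :=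
  colimit.ι (latchingDiagram X n) f

/-- The latching map `L_n X ⟶ X ⦋n⦌`. -/
noncomputable def latchingMap (X : SimplexCategory ⥤ C) (n : ℕ) :
    latchingObj X n ⟶ X.obj ⦋n⦌ :=
  colimit.desc (latchingDiagram X n)
    { pt := X.obj ⦋n⦌
      ι :=
        { app := fun f => X.map f.obj.hom
          naturality := fun _ _ φ =>
            ((X.map_comp _ _).symm.trans (congrArg X.map (Over.w φ.hom))).trans
              (Category.comp_id _).symm } }

/-- The map `L_n X ⟶ L_n Y` induced by `φ : X ⟶ Y`. -/
noncomputable def latchingObjMap {X Y : SimplexCategory ⥤ C} (φ : X ⟶ Y) (n : ℕ) :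
    latchingObj X n ⟶ latchingObj Y n :=
  colim.map (X := latchingDiagram X n) (Y := latchingDiagram Y n)
    { app := fun f => φ.app f.obj.left
      naturality := fun _ _ a => φ.naturality a.hom.left }

theorem latchingι_map (X : SimplexCategory ⥤ C) (n : ℕ) (f : LatchingCategory n) :
    latchingι X n f ≫ latchingMap X n = X.map f.obj.hom :=
  colimit.ι_desc _ _

theorem latchingι_objMap {X Y : SimplexCategory ⥤ C} (φ : X ⟶ Y) (n : ℕ)
    (f : LatchingCategory n) :
    latchingι X n f ≫ latchingObjMap φ n = φ.app f.obj.left ≫ latchingι Y n f :=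
  colimit.ι_map _ _

theorem latchingObj_hom_ext {X : SimplexCategory ⥤ C} {n : ℕ} {T : C}
    {g h : latchingObj X n ⟶ T} (H : ∀ f, latchingι X n f ≫ g = latchingι X n f ≫ h) : g = h :=
  colimit.hom_ext H

theorem latchingMap_naturality {X Y : SimplexCategory ⥤ C} (φ : X ⟶ Y) (n : ℕ) :
    latchingMap X n ≫ φ.app ⦋n⦌ = latchingObjMap φ n ≫ latchingMap Y n :=
  latchingObj_hom_ext fun f => by
    rw [reassoc_of% latchingι_map X n f, reassoc_of% latchingι_objMap φ n f, latchingι_map,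
      φ.naturality]

/-- The relative latching map `X ⦋n⦌ ⨿_{L_n X} L_n Y ⟶ Y ⦋n⦌`. -/
noncomputable def relativeLatchingMap {X Y : SimplexCategory ⥤ C} (φ : X ⟶ Y) (n : ℕ) :
    pushout (latchingMap X n) (latchingObjMap φ n) ⟶ Y.obj ⦋n⦌ :=
  pushout.desc (φ.app ⦋n⦌) (latchingMap Y n) (latchingMap_naturality φ n)

end Reedy

section ModelCategory

variable [ModelCategory C]

/-- A map of cosimplicial objects is a Reedy cofibration if all its relative latching maps are
cofibrations. -/
def IsReedyCofibration {X Y : SimplexCategory ⥤ C} (φ : X ⟶ Y) : Prop :=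
  ∀ n : ℕ, Cofibration (relativeLatchingMap φ n)

/-- A cosimplicial object is Reedy cofibrant if the map from the initial object is a Reedy
cofibration; since `L_n ∅ = ∅`, this says that all the latching maps are cofibrations. -/
def IsReedyCofibrant (X : SimplexCategory ⥤ C) : Prop :=
  ∀ n : ℕ, Cofibration (latchingMap X n)

/-- The weak equivalences of the Reedy model structure are the levelwise weak equivalences. -/
def IsReedyWeakEquivalence {X Y : SimplexCategory ⥤ C} (φ : X ⟶ Y) : Prop :=
  ∀ n : SimplexCategory, WeakEquivalence (φ.app n)

/-- A cosimplicial resolution of `X`: a Reedy cofibrant replacement of the constant functor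
on `X`. -/
structure CosimplicialResolution (X : C) where
  obj : SimplexCategory ⥤ C
  toConst : obj ⟶ (Functor.const SimplexCategory).obj X
  isReedyCofibrant : IsReedyCofibrant obj
  isReedyWeakEquivalence : IsReedyWeakEquivalence toConst

/-- A cofibrant cosimplicial resolution of a map `f : X ⟶ Y`: cosimplicial resolutions of `X` and
`Y` together with a Reedy cofibration between them lying over `f`. -/
structure CofibrantCosimplicialResolution {X Y : C} (f : X ⟶ Y) where
  source : CosimplicialResolution X
  target : CosimplicialResolution Y
  hom : source.obj ⟶ target.obj
  isReedyCofibration : IsReedyCofibration hom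
  comm : hom ≫ target.toConst = source.toConst ≫ (Functor.const SimplexCategory).map f

end ModelCategory

/-! ### The object `X ⊗ K` -/

/-- The Yoneda embedding `⦋m⦌ ↦ Δ[m]`, that is, `SSet.stdSimplex` as a functor. -/
abbrev simplexFunctor : SimplexCategory ⥤ SSet.{v} := uliftYoneda.{v}

/-- The diagram of shape `Δ ↓ K` (the category of simplices `Δ[m] ⟶ K`) which sends such a simplex
to `X ⦋m⦌`. -/
@[simps]
def tensorDiagram (X : SimplexCategory ⥤ C) (K : SSet.{v}) :
    CostructuredArrow simplexFunctor.{v} K ⥤ C where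
  obj x := X.obj x.left
  map f := X.map f.left

/-- `X ⊗ K` for a cosimplicial object `X` and a simplicial set `K`: the colimit of `X ⦋m⦌` over
the simplices `Δ[m] ⟶ K` of `K`. -/
noncomputable def tensorObj (X : SimplexCategory ⥤ C) (K : SSet.{v})
    [HasColimit (tensorDiagram X K)] : C :=
  colimit (tensorDiagram X K)

/-- The canonical map `X ⦋m⦌ ⟶ X ⊗ K` for a simplex `Δ[m] ⟶ K`. -/
noncomputable def tensorι (X : SimplexCategory ⥤ C) (K : SSet.{v})
    [HasColimit (tensorDiagram X K)] (x : CostructuredArrow simplexFunctor.{v} K) :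
    X.obj x.left ⟶ tensorObj X K :=
  colimit.ι (tensorDiagram X K) x

/-- The map `X ⊗ K ⟶ Y ⊗ K` induced by `φ : X ⟶ Y`. -/
noncomputable def tensorMapLeft {X Y : SimplexCategory ⥤ C} (φ : X ⟶ Y) (K : SSet.{v})
    [HasColimit (tensorDiagram X K)] [HasColimit (tensorDiagram Y K)] :
    tensorObj X K ⟶ tensorObj Y K :=
  colimit.desc (tensorDiagram X K)
    { pt := tensorObj Y K
      ι :=
        { app := fun x => φ.app x.left ≫ tensorι Y K x
          naturality := fun x _ f =>
            ((φ.naturality_assoc f.left _).trans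
              (congrArg (φ.app x.left ≫ ·) (colimit.w (tensorDiagram Y K) f))).trans
              (Category.comp_id _).symm } }

/-- The map `X ⊗ K ⟶ X ⊗ L` induced by `i : K ⟶ L`. -/
noncomputable def tensorMapRight (X : SimplexCategory ⥤ C) {K L : SSet.{v}} (i : K ⟶ L)
    [HasColimit (tensorDiagram X K)] [HasColimit (tensorDiagram X L)] :
    tensorObj X K ⟶ tensorObj X L :=
  colimit.desc (tensorDiagram X K)
    { pt := tensorObj X L
      ι :=
        { app := fun x => tensorι X L ((CostructuredArrow.map i).obj x)
          naturality := fun _ _ f =>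
            (colimit.w (tensorDiagram X L) ((CostructuredArrow.map i).map f)).trans
              (Category.comp_id _).symm } }

theorem tensorι_mapLeft {X Y : SimplexCategory ⥤ C} (φ : X ⟶ Y) (K : SSet.{v})
    [HasColimit (tensorDiagram X K)] [HasColimit (tensorDiagram Y K)]
    (x : CostructuredArrow simplexFunctor.{v} K) :
    tensorι X K x ≫ tensorMapLeft φ K = φ.app x.left ≫ tensorι Y K x :=
  colimit.ι_desc _ _

theorem tensorι_mapRight (X : SimplexCategory ⥤ C) {K L : SSet.{v}} (i : K ⟶ L)
    [HasColimit (tensorDiagram X K)] [HasColimit (tensorDiagram X L)]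
    (x : CostructuredArrow simplexFunctor.{v} K) :
    tensorι X K x ≫ tensorMapRight X i = tensorι X L ((CostructuredArrow.map i).obj x) :=
  colimit.ι_desc _ _

theorem tensorObj_hom_ext {X : SimplexCategory ⥤ C} {K : SSet.{v}} [HasColimit (tensorDiagram X K)]
    {T : C} {g h : tensorObj X K ⟶ T} (H : ∀ x, tensorι X K x ≫ g = tensorι X K x ≫ h) : g = h :=
  colimit.hom_ext H

theorem tensorMap_comm {X Y : SimplexCategory ⥤ C} (φ : X ⟶ Y) {K L : SSet.{v}} (i : K ⟶ L)
    [HasColimit (tensorDiagram X K)] [HasColimit (tensorDiagram X L)]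
    [HasColimit (tensorDiagram Y K)] [HasColimit (tensorDiagram Y L)] :
    tensorMapRight X i ≫ tensorMapLeft φ L = tensorMapLeft φ K ≫ tensorMapRight Y i :=
  tensorObj_hom_ext fun x => by
    rw [reassoc_of% tensorι_mapRight X i x, reassoc_of% tensorι_mapLeft φ K x, tensorι_mapRight,
      tensorι_mapLeft]
    rfl

instance hasColimit_tensorDiagram_stdSimplex (X : SimplexCategory ⥤ C) (n : ℕ) :
    HasColimit (tensorDiagram X (Δ[n] : SSet.{v})) := by
  have := (CostructuredArrow.mkIdTerminal (S := simplexFunctor.{v}) (Y := ⦋n⦌)).hasTerminal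
  exact inferInstanceAs (HasColimit (tensorDiagram X (simplexFunctor.{v}.obj ⦋n⦌)))

/-- The simplicial set `∂Δ[n]`. -/
abbrev bdry (n : ℕ) : SSet.{v} := ((∂Δ[n] : (Δ[n] : SSet.{v}).Subcomplex) : SSet.{v})

/-- The inclusion `∂Δ[n] ⟶ Δ[n]`. -/
abbrev bdryι (n : ℕ) : bdry.{v} n ⟶ (Δ[n] : SSet.{v}) :=
  (∂Δ[n] : (Δ[n] : SSet.{v}).Subcomplex).ι

/-- The simplex `Δ[m] ⟶ ∂Δ[n]` given by a non-surjective map `f : ⦋m⦌ ⟶ ⦋n⦌`. -/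
def bdrySimplex {n : ℕ} {m : SimplexCategory} (f : m ⟶ ⦋n⦌) (hf : ¬ Epi f) :
    simplexFunctor.{v}.obj m ⟶ bdry.{v} n :=
  SSet.Subcomplex.lift (X := simplexFunctor.{v}.obj m) (B := ∂Δ[n])
    (simplexFunctor.{v}.map f) (by
    rintro k _ ⟨g, rfl⟩ hg
    refine hf (SimplexCategory.epi_iff_surjective.2 ?_)
    exact Function.Surjective.of_comp (g := g.down.toOrderHom) hg)

theorem not_epi_of_latching {n : ℕ} (f : LatchingCategory n) : ¬ Epi f.obj.hom := by
  intro h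
  have := f.property.1
  exact f.property.2 (SimplexCategory.isIso_of_bijective
    ⟨SimplexCategory.mono_iff_injective.1 f.property.1, SimplexCategory.epi_iff_surjective.1 h⟩)

/-- The functor from the latching category of `⦋n⦌` to the category of simplices of `∂Δ[n]`. -/
def latchingToBdry (n : ℕ) :
    LatchingCategory n ⥤ CostructuredArrow simplexFunctor.{v} (bdry.{v} n) where
  obj f := CostructuredArrow.mk (bdrySimplex f.obj.hom (not_epi_of_latching f))
  map {f g} φ := CostructuredArrow.homMk φ.hom.left (by
    rw [← cancel_mono (SSet.Subcomplex.ι _)]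
    change simplexFunctor.map _ ≫ simplexFunctor.map _ = simplexFunctor.map _
    rw [← Functor.map_comp]
    congr 1
    exact Over.w φ.hom)

/-- Every simplex of `∂Δ[n]` is given by a non-surjective map. -/
theorem exists_bdrySimplex {n : ℕ} {m : SimplexCategory}
    (x : simplexFunctor.{v}.obj m ⟶ bdry.{v} n) :
    ∃ (f : m ⟶ ⦋n⦌) (hf : ¬ Epi f), x = bdrySimplex f hf := by
  obtain ⟨f, hf⟩ := simplexFunctor.{v}.map_surjective (X := m) (Y := ⦋n⦌)
    (x ≫ (∂Δ[n] : (Δ[n] : SSet.{v}).Subcomplex).ι)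
  refine ⟨f, fun h => ?_, ?_⟩
  · have h1 := (x.app (Opposite.op m) ⟨𝟙 m⟩).2
    apply h1
    have h3 := congrArg (fun α : simplexFunctor.{v}.obj m ⟶ simplexFunctor.{v}.obj ⦋n⦌ =>
      α.app (Opposite.op m) ⟨𝟙 m⟩) hf
    have h4 : (⟨𝟙 m ≫ f⟩ : ULift (m ⟶ ⦋n⦌)) = (x.app (Opposite.op m) ⟨𝟙 m⟩).1 := h3
    rw [← h4]
    rw [Category.id_comp]
    exact SimplexCategory.epi_iff_surjective.1 h
  · rw [← cancel_mono (SSet.Subcomplex.ι _)]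
    exact hf.symm

theorem bdrySimplex_naturality {n : ℕ} {m k : SimplexCategory} (g : m ⟶ k) (f : k ⟶ ⦋n⦌)
    (hf : ¬ Epi f) (hgf : ¬ Epi (g ≫ f)) :
    simplexFunctor.{v}.map g ≫ bdrySimplex f hf = bdrySimplex (g ≫ f) hgf := by
  rw [← cancel_mono (SSet.Subcomplex.ι _)]
  exact (simplexFunctor.{v}.map_comp g f).symm

theorem bdrySimplex_injective {n : ℕ} {m : SimplexCategory} {f g : m ⟶ ⦋n⦌}
    {hf : ¬ Epi f} {hg : ¬ Epi g} (h : bdrySimplex.{v} f hf = bdrySimplex g hg) : f = g :=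
  simplexFunctor.{v}.map_injective (congrArg (· ≫ SSet.Subcomplex.ι _) h)

instance final_latchingToBdry (n : ℕ) : (latchingToBdry.{v} n).Final where
  out d := by
    obtain ⟨m, ⟨⟨⟩⟩, x⟩ := d
    obtain ⟨f, hf, rfl⟩ := exists_bdrySimplex x
    have hι : ¬ Epi (image.ι f) := fun h => hf (by
      rw [← image.fac f]
      exact epi_comp _ _)
    let A : LatchingCategory n :=
      ⟨Over.mk (image.ι f), inferInstanceAs (Mono (image.ι f)),
        fun h => hι (have : IsIso (image.ι f) := h; inferInstance)⟩
    let c : StructuredArrow (CostructuredArrow.mk (bdrySimplex f hf)) (latchingToBdry.{v} n) :=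
      StructuredArrow.mk (Y := A) (CostructuredArrow.homMk (factorThruImage f) (by
        refine (bdrySimplex_naturality (factorThruImage f) (image.ι f) hι (by simpa)).trans ?_
        congr 1
        exact image.fac f))
    have hfac (s : StructuredArrow (CostructuredArrow.mk (bdrySimplex f hf))
        (latchingToBdry.{v} n)) : s.hom.left ≫ s.right.obj.hom = f :=
      bdrySimplex_injective (hf := fun h => not_epi_of_latching s.right (epi_of_epi s.hom.left _))
        (hg := hf) ((bdrySimplex_naturality _ _ (not_epi_of_latching s.right) _).symm.trans
          (CostructuredArrow.w s.hom))
    let F (s : StructuredArrow (CostructuredArrow.mk (bdrySimplex f hf))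
        (latchingToBdry.{v} n)) : MonoFactorisation f :=
      { I := s.right.obj.left
        m := s.right.obj.hom
        m_mono := s.right.property.1
        e := s.hom.left
        fac := hfac s }
    let l (s : StructuredArrow (CostructuredArrow.mk (bdrySimplex f hf))
        (latchingToBdry.{v} n)) : c ⟶ s :=
      StructuredArrow.homMk (ObjectProperty.homMk (Over.homMk (image.lift (F s))
        (image.lift_fac (F s)))) (by
          apply CostructuredArrow.hom_ext
          exact image.fac_lift (F s))
    have hc : IsInitial c := IsInitial.ofUniqueHom l (fun s g => by
      apply StructuredArrow.hom_ext
      apply ObjectProperty.hom_ext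
      apply Over.OverMorphism.ext
      have := s.right.property.1
      rw [← cancel_mono s.right.obj.hom]
      exact (Over.w g.right.hom).trans (Over.w (l s).right.hom).symm)
    have : HasInitial (StructuredArrow (CostructuredArrow.mk (bdrySimplex f hf))
      (latchingToBdry.{v} n)) := hc.hasInitial
    exact isConnected_of_hasInitial (StructuredArrow (CostructuredArrow.mk (bdrySimplex f hf))
      (latchingToBdry.{v} n))

instance hasColimit_tensorDiagram_bdry [HasFiniteColimits C] (X : SimplexCategory ⥤ C) (n : ℕ) :
    HasColimit (tensorDiagram X (bdry.{v} n)) := by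
  have : HasColimit (latchingToBdry.{v} n ⋙ tensorDiagram X (bdry.{v} n)) := inferInstance
  exact Functor.Final.hasColimit_of_comp (latchingToBdry.{v} n)

/-! ### Horns -/

section Horns

variable [HasFiniteColimits C]

/-- The map
`(X ⊗ Δ[n]) ⨿_{X ⊗ ∂Δ[n]} (Y ⊗ ∂Δ[n]) ⟶ Y ⊗ Δ[n]` induced by a map `φ : X ⟶ Y` of cosimplicial
objects. -/
noncomputable def hornMap {X Y : SimplexCategory ⥤ C} (φ : X ⟶ Y) (n : ℕ) :
    pushout (tensorMapRight X (bdryι.{v} n)) (tensorMapLeft φ (bdry.{v} n)) ⟶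
      tensorObj Y (Δ[n] : SSet.{v}) :=
  pushout.desc (tensorMapLeft φ Δ[n]) (tensorMapRight Y (bdryι.{v} n))
    (tensorMap_comm φ (bdryι.{v} n))

end Horns

section Localization

variable [ModelCategory C]

/-- `Λ` is a class of horns on `S`: for every `f : X ⟶ Y` in `S` there is a chosen nonempty class
of cofibrant cosimplicial resolutions of `f` (a single one if `Λ` is built from one choice of a
resolution for each `f`, all of them if `Λ` is built from all the resolutions), and `Λ` consists of
the maps isomorphic to `hornMap R.hom n` for these resolutions `R` and all `n`. -/
def IsClassOfHorns (S Λ : MorphismProperty C) : Prop :=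
  ∃ R : ∀ ⦃X Y : C⦄ (f : X ⟶ Y), S f → Set (CofibrantCosimplicialResolution f),
    (∀ ⦃X Y : C⦄ (f : X ⟶ Y) (hf : S f), (R f hf).Nonempty) ∧
    ∀ ⦃A B : C⦄ (g : A ⟶ B), Λ g ↔
      ∃ (X Y : C) (f : X ⟶ Y) (hf : S f), ∃ r ∈ R f hf, ∃ n : ℕ,
        Nonempty (Arrow.mk g ≅ Arrow.mk (hornMap r.hom n))

/-- A map of cylinder objects over `i : U ⟶ V`. -/
structure CylinderMap {D : Type*} [Category* D] [CategoryWithWeakEquivalences D] {U V : D}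
    (i : U ⟶ V) (P : Cylinder U) (Q : Cylinder V) where
  hom : P.I ⟶ Q.I
  i₀_comm : P.i₀ ≫ hom = i ≫ Q.i₀
  i₁_comm : P.i₁ ≫ hom = i ≫ Q.i₁
  π_comm : hom ≫ Q.π = P.π ≫ i

/-- The map `C(U) ⨿_{U ⨿ U} (V ⨿ V) ⟶ C(V)` induced by a map of cylinder objects. -/
noncomputable def CylinderMap.cornerMap {D : Type*} [Category* D] [ModelCategory D] {U V : D}
    {i : U ⟶ V} {P : Cylinder U} {Q : Cylinder V} (c : CylinderMap i P Q) :
    pushout P.i (coprod.map i i) ⟶ Q.I :=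
  pushout.desc c.hom Q.i (by
    ext
    · simp [c.i₀_comm]
    · simp [c.i₁_comm])

/-- `S` is closed under coidentity types. Cylinder objects and fibrant objects are those of the
slice model category `C / Γ`, and cylinder objects are good: `U ⨿ U ⟶ C(U)` is a cofibration. -/
def IsClosedUnderCoidentityTypes (S : MorphismProperty C) : Prop :=
  ∀ (Γ : C) ⦃U V : Over Γ⦄ (i : U ⟶ V), S i.left →
    ∃ (P : Cylinder U) (Q : Cylinder V) (c : CylinderMap i P Q), P.IsGood ∧ Q.IsGood ∧
      ∀ E : Over Γ, IsFibrant E → S.rlp E.hom →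
        HasLiftingProperty c.cornerMap (terminal.from E)

end Localization

end CosimplicialResolutions

/-! Maps `X ⊗ K ⟶ Z` are the same as maps of simplicial sets `K ⟶ homSSet X Z` (`tensorEquiv`), so
lifting problems in `C` become lifting problems in simplicial sets. If `X` is Reedy cofibrant,
`homSSet X` turns trivial fibrations into trivial Kan fibrations; if moreover the structure maps of
`X` are weak equivalences, as in a resolution, it turns fibrations into Kan fibrations
(`fibration_homSSetMap`). If `p : E ⟶ B` lifts against all the horn maps of `φ : X ⟶ Y`, then
`homSSet Y E ⟶ homSSet X E ×_{homSSet X B} homSSet Y B` lifts against every monomorphism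
(`rlp_monomorphisms_homCorner`).

For a horn `U ⟶ V` with `U = (X ⊗ Δ[n]) ⨿_{X ⊗ ∂Δ[n]} (Y ⊗ ∂Δ[n])` and `V = Y ⊗ Δ[n]`, the cylinders
are obtained by multiplying each of `∂Δ[n]` and `Δ[n]` by `Δ[1]`. Over `Γ` they carry the structure
maps pulled back along the projections. By the two statements about `homSSet`, they are good
cylinders. The map `C(U) ⨿_{U ⨿ U} (V ⨿ V) ⟶ C(V)` is the corner map of `φ` with the monomorphism
`∂Δ[n] × Δ[1] ∪ Δ[n] × ∂Δ[1] ⊆ Δ[n] × Δ[1]`. Lifting it against `E ⟶ Γ` is thus an extension problem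
along a monomorphism for `homCorner`, solved in `exists_lift_cornerTo`. Since that monomorphism
involves simplices of several dimensions, `Λ(S)` must contain the horns of one resolution for all
`n` at once. -/

namespace CosimplicialResolutions

/-! ### The adjunction between `X ⊗ -` and `homSSet X` -/

section HomSSet

variable {C : Type u} [Category.{v} C]

/-- The simplicial set `⦋m⦌ ↦ (X ⦋m⦌ ⟶ Z)` attached to a cosimplicial object `X`. -/
abbrev homSSet (X : SimplexCategory ⥤ C) (Z : C) : SSet.{v} := X.op ⋙ yoneda.obj Z

/-- Functoriality of `homSSet` in the target. -/
abbrev homSSetMap (X : SimplexCategory ⥤ C) {Z Z' : C} (p : Z ⟶ Z') :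
    homSSet X Z ⟶ homSSet X Z' :=
  Functor.whiskerLeft X.op (yoneda.map p)

/-- Functoriality of `homSSet` in the cosimplicial object. -/
abbrev homSSetPre {X Y : SimplexCategory ⥤ C} (φ : X ⟶ Y) (Z : C) :
    homSSet Y Z ⟶ homSSet X Z :=
  Functor.whiskerRight (NatTrans.op φ) (yoneda.obj Z)

theorem homSSetMap_pre {X Y : SimplexCategory ⥤ C} (φ : X ⟶ Y) {Z Z' : C} (p : Z ⟶ Z') :
    homSSetMap Y p ≫ homSSetPre φ Z' = homSSetPre φ Z ≫ homSSetMap X p := by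
  ext m k
  simp

theorem tensorι_w (X : SimplexCategory ⥤ C) (K : SSet.{v}) [HasColimit (tensorDiagram X K)]
    {x y : CostructuredArrow simplexFunctor.{v} K} (a : x ⟶ y) :
    X.map a.left ≫ tensorι X K y = tensorι X K x :=
  colimit.w (tensorDiagram X K) a

/-- The map `K ⟶ homSSet X Z` given by a cocone under the diagram defining `X ⊗ K`. -/
def homSSetOfCocone {X : SimplexCategory ⥤ C} {K : SSet.{v}} (s : Cocone (tensorDiagram X K)) :
    K ⟶ homSSet X s.pt where
  app m := ↾fun k => s.ι.app (CostructuredArrow.mk (Y := m.unop) (uliftYonedaEquiv.symm k))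
  naturality m m' f := by
    ext k
    exact (s.w (CostructuredArrow.homMk f.unop (uliftYonedaEquiv_symm_map f k).symm :
      CostructuredArrow.mk (Y := m'.unop) (uliftYonedaEquiv.symm (K.map f k)) ⟶
      CostructuredArrow.mk (Y := m.unop) (uliftYonedaEquiv.symm k))).symm

/-- The cocone under the diagram defining `X ⊗ K` given by a map `K ⟶ homSSet X Z`. -/
def coconeOfHomSSet {X : SimplexCategory ⥤ C} {K : SSet.{v}} {Z : C} (f : K ⟶ homSSet X Z) :
    Cocone (tensorDiagram X K) where
  pt := Z
  ι :=
    { app := fun x => f.app (.op x.left) (uliftYonedaEquiv x.hom)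
      naturality := fun x y a => by
        refine Eq.trans ?_ (Category.comp_id _).symm
        have h1 := uliftYonedaEquiv_naturality y.hom a.left.op
        have h2 := NatTrans.naturality_apply f a.left.op (uliftYonedaEquiv y.hom)
        rw [h1] at h2
        refine h2.symm.trans ?_
        congr 2
        exact CostructuredArrow.w a }

theorem homSSetOfCocone_app_yoneda {X : SimplexCategory ⥤ C} {K : SSet.{v}}
    (s : Cocone (tensorDiagram X K)) (x : CostructuredArrow simplexFunctor.{v} K) :
    (homSSetOfCocone s).app (.op x.left) (uliftYonedaEquiv x.hom) = s.ι.app x := by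
  obtain ⟨m, ⟨⟨⟩⟩, x⟩ := x
  change s.ι.app (CostructuredArrow.mk (uliftYonedaEquiv.symm (uliftYonedaEquiv x))) = _
  rw [Equiv.symm_apply_apply]
  rfl

/-- The universal property of `X ⊗ K`. -/
noncomputable def tensorEquiv (X : SimplexCategory ⥤ C) (K : SSet.{v})
    [HasColimit (tensorDiagram X K)] (Z : C) : (tensorObj X K ⟶ Z) ≃ (K ⟶ homSSet X Z) where
  toFun g := homSSetOfCocone ((colimit.cocone (tensorDiagram X K)).extend g)
  invFun f := colimit.desc (tensorDiagram X K) (coconeOfHomSSet f)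
  left_inv g := tensorObj_hom_ext fun x =>
    (colimit.ι_desc _ _).trans (homSSetOfCocone_app_yoneda _ x)
  right_inv f := by
    ext m k
    refine (colimit.ι_desc _ _).trans ?_
    change f.app m (uliftYonedaEquiv (uliftYonedaEquiv.symm k)) = f.app m k
    rw [Equiv.apply_symm_apply]

theorem tensorEquiv_comp (X : SimplexCategory ⥤ C) (K : SSet.{v})
    [HasColimit (tensorDiagram X K)] {Z Z' : C} (g : tensorObj X K ⟶ Z) (p : Z ⟶ Z') :
    tensorEquiv X K Z' (g ≫ p) = tensorEquiv X K Z g ≫ homSSetMap X p := by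
  ext m k
  exact (Category.assoc _ _ _).symm

theorem tensorEquiv_mapRight (X : SimplexCategory ⥤ C) {K L : SSet.{v}} (i : K ⟶ L)
    [HasColimit (tensorDiagram X K)] [HasColimit (tensorDiagram X L)] {Z : C}
    (g : tensorObj X L ⟶ Z) :
    tensorEquiv X K Z (tensorMapRight X i ≫ g) = i ≫ tensorEquiv X L Z g := by
  ext m k
  change tensorι X K (CostructuredArrow.mk (Y := m.unop) (uliftYonedaEquiv.symm k)) ≫
    tensorMapRight X i ≫ g =
    tensorι X L (CostructuredArrow.mk (Y := m.unop) (uliftYonedaEquiv.symm (i.app m k))) ≫ g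
  rw [reassoc_of% tensorι_mapRight, ← uliftYonedaEquiv_symm_comp]
  rfl

theorem tensorEquiv_mapLeft {X Y : SimplexCategory ⥤ C} (φ : X ⟶ Y) (K : SSet.{v})
    [HasColimit (tensorDiagram X K)] [HasColimit (tensorDiagram Y K)] {Z : C}
    (g : tensorObj Y K ⟶ Z) :
    tensorEquiv X K Z (tensorMapLeft φ K ≫ g) = tensorEquiv Y K Z g ≫ homSSetPre φ Z := by
  ext m k
  change tensorι X K (CostructuredArrow.mk (Y := m.unop) (uliftYonedaEquiv.symm k)) ≫
    tensorMapLeft φ K ≫ g = _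
  rw [reassoc_of% tensorι_mapLeft]
  rfl

theorem tensorEquiv_symm_comp (X : SimplexCategory ⥤ C) (K : SSet.{v})
    [HasColimit (tensorDiagram X K)] {Z Z' : C} (f : K ⟶ homSSet X Z) (p : Z ⟶ Z') :
    (tensorEquiv X K Z).symm f ≫ p = (tensorEquiv X K Z').symm (f ≫ homSSetMap X p) :=
  (tensorEquiv X K Z').injective (by simp [tensorEquiv_comp])

theorem mapRight_tensorEquiv_symm (X : SimplexCategory ⥤ C) {K L : SSet.{v}} (i : K ⟶ L)
    [HasColimit (tensorDiagram X K)] [HasColimit (tensorDiagram X L)] {Z : C}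
    (f : L ⟶ homSSet X Z) :
    tensorMapRight X i ≫ (tensorEquiv X L Z).symm f = (tensorEquiv X K Z).symm (i ≫ f) :=
  (tensorEquiv X K Z).injective (by simp [tensorEquiv_mapRight])

theorem mapLeft_tensorEquiv_symm {X Y : SimplexCategory ⥤ C} (φ : X ⟶ Y) (K : SSet.{v})
    [HasColimit (tensorDiagram X K)] [HasColimit (tensorDiagram Y K)] {Z : C}
    (f : K ⟶ homSSet Y Z) :
    tensorMapLeft φ K ≫ (tensorEquiv Y K Z).symm f =
      (tensorEquiv X K Z).symm (f ≫ homSSetPre φ Z) :=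
  (tensorEquiv X K Z).injective (by simp [tensorEquiv_mapLeft])

theorem tensorMapRight_id (X : SimplexCategory ⥤ C) (K : SSet.{v})
    [HasColimit (tensorDiagram X K)] : tensorMapRight X (𝟙 K) = 𝟙 _ :=
  (tensorEquiv X K _).injective (by
    -- The identity is appended because `tensorEquiv_mapRight` speaks of composites.
    rw [← Category.comp_id (tensorMapRight X (𝟙 K)), tensorEquiv_mapRight, Category.id_comp])

theorem tensorMapRight_comp (X : SimplexCategory ⥤ C) {K L M : SSet.{v}} (i : K ⟶ L) (j : L ⟶ M)
    [HasColimit (tensorDiagram X K)] [HasColimit (tensorDiagram X L)]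
    [HasColimit (tensorDiagram X M)] :
    tensorMapRight X (i ≫ j) = tensorMapRight X i ≫ tensorMapRight X j :=
  (tensorEquiv X K _).injective (by
    rw [← Category.comp_id (tensorMapRight X (i ≫ j)), tensorEquiv_mapRight,
      tensorEquiv_mapRight, ← Category.comp_id (tensorMapRight X j), tensorEquiv_mapRight,
      Category.assoc])

/-- Lifting problems for `X ⊗ K ⟶ X ⊗ L` correspond to lifting problems for `K ⟶ L`. -/
theorem hasLiftingProperty_tensorMapRight_iff (X : SimplexCategory ⥤ C) {K L : SSet.{v}}
    (i : K ⟶ L) [HasColimit (tensorDiagram X K)] [HasColimit (tensorDiagram X L)]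
    {E B : C} (p : E ⟶ B) :
    HasLiftingProperty (tensorMapRight X i) p ↔ HasLiftingProperty i (homSSetMap X p) := by
  refine ⟨fun h => ⟨fun {f g} sq => ?_⟩, fun h => ⟨fun {f g} sq => ?_⟩⟩
  · have sq' : CommSq ((tensorEquiv X K E).symm f) (tensorMapRight X i) p
        ((tensorEquiv X L B).symm g) :=
      ⟨by rw [tensorEquiv_symm_comp, mapRight_tensorEquiv_symm, sq.w]⟩
    exact ⟨⟨{ l := tensorEquiv X L E sq'.lift
              fac_left := by rw [← tensorEquiv_mapRight, sq'.fac_left, Equiv.apply_symm_apply]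
              fac_right := by rw [← tensorEquiv_comp, sq'.fac_right, Equiv.apply_symm_apply] }⟩⟩
  · have sq' : CommSq (tensorEquiv X K E f) i (homSSetMap X p) (tensorEquiv X L B g) :=
      ⟨by rw [← tensorEquiv_comp, ← tensorEquiv_mapRight, sq.w]⟩
    exact ⟨⟨{ l := (tensorEquiv X L E).symm sq'.lift
              fac_left := by
                rw [mapRight_tensorEquiv_symm, sq'.fac_left, Equiv.symm_apply_apply]
              fac_right := by
                rw [tensorEquiv_symm_comp, sq'.fac_right, Equiv.symm_apply_apply] }⟩⟩

/-- The map `homSSet Y E ⟶ homSSet X E ×_{homSSet X B} homSSet Y B`. -/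
noncomputable def homCorner {X Y : SimplexCategory ⥤ C} (φ : X ⟶ Y) {E B : C} (p : E ⟶ B) :
    homSSet Y E ⟶ pullback (homSSetMap X p) (homSSetPre φ B) :=
  pullback.lift (homSSetPre φ E) (homSSetMap Y p) (homSSetMap_pre φ p).symm

/-- A lifting property of the horn map `hornMap φ n` yields a lifting property of
`∂Δ[n] ⟶ Δ[n]`. -/
theorem hasLiftingProperty_homCorner [HasFiniteColimits C] {X Y : SimplexCategory ⥤ C}
    (φ : X ⟶ Y) (n : ℕ) {E B : C} (p : E ⟶ B) [HasLiftingProperty (hornMap φ n) p] :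
    HasLiftingProperty (bdryι.{v} n) (homCorner φ p) := by
  refine ⟨fun {f g} sq => ?_⟩
  have w1 : f ≫ homSSetPre φ E = bdryι n ≫ g ≫ pullback.fst _ _ := by
    rw [← sq.w_assoc, homCorner, pullback.lift_fst]
  have w2 : f ≫ homSSetMap Y p = bdryι n ≫ g ≫ pullback.snd _ _ := by
    rw [← sq.w_assoc, homCorner, pullback.lift_snd]
  -- The transposed square: the map on `Δ[n]` into the pullback splits into a map out of `X ⊗ Δ[n]`
  -- to `E` and one out of `Y ⊗ Δ[n]` to `B`.
  have sq' : CommSq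
      (pushout.desc ((tensorEquiv X Δ[n] E).symm (g ≫ pullback.fst _ _))
        ((tensorEquiv Y (bdry n) E).symm f)
        (by rw [mapRight_tensorEquiv_symm, mapLeft_tensorEquiv_symm, w1]))
      (hornMap φ n) p ((tensorEquiv Y Δ[n] B).symm (g ≫ pullback.snd _ _)) := ⟨by
    unfold hornMap
    apply pushout.hom_ext
    · rw [pushout.inl_desc_assoc, pushout.inl_desc_assoc, tensorEquiv_symm_comp,
        mapLeft_tensorEquiv_symm, Category.assoc, Category.assoc, pullback.condition]
    · rw [pushout.inr_desc_assoc, pushout.inr_desc_assoc, tensorEquiv_symm_comp,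
        mapRight_tensorEquiv_symm, w2]⟩
  have h1 : tensorMapLeft φ Δ[n] ≫ sq'.lift =
      (tensorEquiv X Δ[n] E).symm (g ≫ pullback.fst _ _) := by
    have := congrArg (pushout.inl _ _ ≫ ·) sq'.fac_left
    exact (pushout.inl_desc_assoc _ _ _ _).symm.trans (this.trans (pushout.inl_desc _ _ _))
  have h2 : tensorMapRight Y (bdryι n) ≫ sq'.lift = (tensorEquiv Y (bdry n) E).symm f := by
    have := congrArg (pushout.inr _ _ ≫ ·) sq'.fac_left
    exact (pushout.inr_desc_assoc _ _ _ _).symm.trans (this.trans (pushout.inr_desc _ _ _))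
  refine ⟨⟨{ l := tensorEquiv Y Δ[n] E sq'.lift
             fac_left := ?_
             fac_right := ?_ }⟩⟩
  · rw [← tensorEquiv_mapRight, h2, Equiv.apply_symm_apply]
  · apply pullback.hom_ext
    · rw [Category.assoc, homCorner, pullback.lift_fst, ← tensorEquiv_mapLeft, h1,
        Equiv.apply_symm_apply]
    · rw [Category.assoc, homCorner, pullback.lift_snd, ← tensorEquiv_comp, sq'.fac_right,
        Equiv.apply_symm_apply]

/-- `homCorner φ p` lifts against all monomorphisms as soon as `p` lifts against the horn
maps of `φ`. -/
theorem rlp_monomorphisms_homCorner [HasFiniteColimits C] {X Y : SimplexCategory ⥤ C}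
    (φ : X ⟶ Y) {E B : C} (p : E ⟶ B) (h : ∀ n, HasLiftingProperty (hornMap φ n) p) :
    (MorphismProperty.monomorphisms SSet.{v}).rlp (homCorner φ p) := by
  -- It suffices to lift against the boundary inclusions, which generate the monomorphisms.
  rw [SSet.rlp_monomorphisms]
  rintro _ _ _ ⟨n⟩
  exact hasLiftingProperty_homCorner φ n p

end HomSSet

/-! ### Existence of `X ⊗ K` from finite colimits alone -/

section Existence

variable {C : Type u} [Category.{v} C] [HasFiniteColimits C]

/-- `X ⊗ K` exists for every finite nonsingular simplicial set `K`, which is a finite colimit of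
standard simplices. -/
instance hasColimit_tensorDiagram (X : SimplexCategory ⥤ C) (K : SSet.{v}) [K.Finite]
    [K.Nonsingular] : HasColimit (tensorDiagram X K) := by
  -- The category of all simplices of `K` need not be finite, but the poset of nondegenerate ones
  -- is. By nonsingularity `K` is the colimit of standard simplices over this poset, so `colimit D`
  -- is the candidate for `X ⊗ K`.
  let D : K.N ⥤ C := SSet.N.toSemiSimplexCategory K ⋙ SemiSimplexCategory.toSimplexCategory ⋙ X
  let _ : FinCategory K.N :=
    { fintypeObj := Fintype.ofFinite _
      fintypeHom := fun _ _ => Fintype.ofFinite _ }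
  let y (σ : K.N) {Z : C} (g : X.obj ⦋σ.dim⦌ ⟶ Z) : simplexFunctor.{v}.obj ⦋σ.dim⦌ ⟶ homSSet X Z :=
    uliftYonedaEquiv.symm (show (homSSet X Z).obj (.op ⦋σ.dim⦌) from g)
  let x (σ : K.N) : CostructuredArrow simplexFunctor.{v} K :=
    CostructuredArrow.mk (Y := ⦋σ.dim⦌) (K.coconeN'.ι.app σ)
  let c : Cocone K.functorN' :=
    { pt := homSSet X (colimit D)
      ι :=
        { app := fun σ => y σ (colimit.ι D σ)
          naturality := fun σ τ a => by
            refine Eq.trans ?_ (Category.comp_id _).symm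
            refine (uliftYonedaEquiv_symm_map
              (SemiSimplexCategory.toSimplexCategory.map
                ((SSet.N.toSemiSimplexCategory K).map a)).op
              (show (homSSet X (colimit D)).obj (.op ⦋τ.dim⦌) from colimit.ι D τ)).symm.trans ?_
            congr 1
            exact colimit.w D a } }
  -- By Yoneda the colimit cocone of `D` glues to a map on `K`. Its transpose is the colimit cocone
  -- to be constructed.
  let f : K ⟶ homSSet X (colimit D) := K.isColimitCoconeN'.desc c
  have hf (σ : K.N) : K.coconeN'.ι.app σ ≫ f = y σ (colimit.ι D σ) := K.isColimitCoconeN'.fac c σ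
  have hf' (σ : K.N) : (coconeOfHomSSet f).ι.app (x σ) = colimit.ι D σ := by
    refine (congrArg uliftYonedaEquiv (hf σ)).trans ?_
    exact Equiv.apply_symm_apply _ _
  let d (s : Cocone (tensorDiagram X K)) : colimit D ⟶ s.pt := colimit.desc D
    { pt := s.pt
      ι :=
        { app := fun σ => s.ι.app (x σ)
          naturality := fun σ τ a => (s.w (CostructuredArrow.homMk
            (SemiSimplexCategory.toSimplexCategory.map ((SSet.N.toSemiSimplexCategory K).map a))
            (K.coconeN'.w a) : x σ ⟶ x τ)).trans (Category.comp_id _).symm } }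
  have hd (s : Cocone (tensorDiagram X K)) (σ : K.N) : colimit.ι D σ ≫ d s = s.ι.app (x σ) :=
    colimit.ι_desc _ _
  -- Compatibility on all simplices follows from that on the nondegenerate ones, since these cover
  -- `K`.
  have hfd (s : Cocone (tensorDiagram X K)) : f ≫ homSSetMap X (d s) = homSSetOfCocone s := by
    refine K.isColimitCoconeN'.hom_ext fun σ => ?_
    refine (Category.assoc _ _ _).symm.trans ((congrArg (· ≫ homSSetMap X (d s)) (hf σ)).trans ?_)
    apply uliftYonedaEquiv.injective
    refine Eq.trans ?_ (homSSetOfCocone_app_yoneda s (x σ)).symm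
    refine Eq.trans ?_ (hd s σ)
    refine (uliftYonedaEquiv_comp (y σ (colimit.ι D σ)) (homSSetMap X (d s))).trans ?_
    refine (congrArg ((homSSetMap X (d s)).app _) (Equiv.apply_symm_apply _ _)).trans ?_
    rfl
  exact ⟨⟨⟨coconeOfHomSSet f,
    { desc := d
      fac := fun s j => by
        refine Eq.trans ?_ (homSSetOfCocone_app_yoneda s j)
        rw [← hfd s]
        rfl
      uniq := fun s m hm => colimit.hom_ext (F := D) fun σ => by
        refine Eq.trans ?_ (hd s σ).symm
        rw [← hf']
        exact hm (x σ) }⟩⟩⟩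

end Existence

/-! ### Comparison with levels and latching objects -/

section Comparison

variable {C : Type u} [Category.{v} C]

/-- The identity is terminal in the category of simplices of `Δ[n]`, and a colimit is computed at a
terminal index. -/
instance isIso_tensorι_id (X : SimplexCategory ⥤ C) (n : ℕ) :
    IsIso (tensorι X (Δ[n] : SSet.{v})
      (CostructuredArrow.mk (Y := ⦋n⦌) (𝟙 (simplexFunctor.{v}.obj ⦋n⦌)))) :=
  have : HasColimit (tensorDiagram X (simplexFunctor.{v}.obj ⦋n⦌)) :=
    hasColimit_tensorDiagram_stdSimplex X n
  isIso_ι_of_isTerminal (CostructuredArrow.mkIdTerminal (S := simplexFunctor.{v}) (Y := ⦋n⦌))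
    (tensorDiagram X (simplexFunctor.{v}.obj ⦋n⦌))

/-- The isomorphism `X ⦋n⦌ ≅ X ⊗ Δ[n]`. -/
noncomputable def tensorStdSimplexIso (X : SimplexCategory ⥤ C) (n : ℕ) :
    X.obj ⦋n⦌ ≅ tensorObj X (Δ[n] : SSet.{v}) :=
  asIso (tensorι X (Δ[n] : SSet.{v})
    (CostructuredArrow.mk (Y := ⦋n⦌) (𝟙 (simplexFunctor.{v}.obj ⦋n⦌))))

theorem tensorStdSimplexIso_hom_comp (X : SimplexCategory ⥤ C) {n : ℕ} {m : SimplexCategory}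
    (f : m ⟶ ⦋n⦌) : X.map f ≫ (tensorStdSimplexIso X n).hom =
      tensorι X (Δ[n] : SSet.{v}) (CostructuredArrow.mk (Y := m) (simplexFunctor.{v}.map f)) :=
  tensorι_w X _ (CostructuredArrow.homMk f (by exact Category.comp_id _) :
    CostructuredArrow.mk (Y := m) (simplexFunctor.{v}.map f) ⟶
    CostructuredArrow.mk (Y := ⦋n⦌) (𝟙 (simplexFunctor.{v}.obj ⦋n⦌)))

theorem tensorStdSimplexIso_naturality (X : SimplexCategory ⥤ C) {m n : ℕ} (f : ⦋m⦌ ⟶ ⦋n⦌) :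
    X.map f ≫ (tensorStdSimplexIso X n).hom =
      (tensorStdSimplexIso X m).hom ≫ tensorMapRight X (SSet.stdSimplex.{v}.map f) := by
  rw [tensorStdSimplexIso_hom_comp]
  refine Eq.trans ?_ (tensorι_mapRight X (SSet.stdSimplex.{v}.map f)
    (CostructuredArrow.mk (Y := ⦋m⦌) (𝟙 (simplexFunctor.{v}.obj ⦋m⦌)))).symm
  rfl

theorem tensorStdSimplexIso_mapLeft {X Y : SimplexCategory ⥤ C} (φ : X ⟶ Y) (n : ℕ) :
    φ.app ⦋n⦌ ≫ (tensorStdSimplexIso Y n).hom =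
      (tensorStdSimplexIso X n).hom ≫ tensorMapLeft φ (Δ[n] : SSet.{v}) :=
  (tensorι_mapLeft φ (Δ[n] : SSet.{v})
    (CostructuredArrow.mk (Y := ⦋n⦌) (𝟙 (simplexFunctor.{v}.obj ⦋n⦌)))).symm

variable [HasFiniteColimits C]

/-- The isomorphism `L_n X ≅ X ⊗ ∂Δ[n]`. -/
noncomputable def latchingIso (X : SimplexCategory ⥤ C) (n : ℕ) :
    latchingObj X n ≅ tensorObj X (bdry.{v} n) :=
  Functor.Final.colimitIso (latchingToBdry.{v} n) (tensorDiagram X (bdry.{v} n))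

theorem latchingι_iso (X : SimplexCategory ⥤ C) (n : ℕ) (f : LatchingCategory n) :
    latchingι X n f ≫ (latchingIso X n).hom = tensorι X _ ((latchingToBdry.{v} n).obj f) :=
  Functor.Final.ι_colimitIso_hom (latchingToBdry.{v} n) (tensorDiagram X (bdry.{v} n)) f

theorem latchingIso_mapRight (X : SimplexCategory ⥤ C) (n : ℕ) :
    latchingMap X n ≫ (tensorStdSimplexIso X n).hom =
      (latchingIso X n).hom ≫ tensorMapRight X (bdryι.{v} n) :=
  latchingObj_hom_ext fun f => by
    rw [reassoc_of% latchingι_map, reassoc_of% latchingι_iso, tensorStdSimplexIso_hom_comp]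
    exact (tensorι_mapRight X (bdryι.{v} n) ((latchingToBdry.{v} n).obj f)).symm

theorem latchingIso_mapLeft {X Y : SimplexCategory ⥤ C} (φ : X ⟶ Y) (n : ℕ) :
    latchingObjMap φ n ≫ (latchingIso Y n).hom =
      (latchingIso X n).hom ≫ tensorMapLeft φ (bdry.{v} n) :=
  latchingObj_hom_ext fun f => by
    rw [reassoc_of% latchingι_objMap, reassoc_of% latchingι_iso, latchingι_iso]
    exact (tensorι_mapLeft φ (bdry.{v} n) ((latchingToBdry.{v} n).obj f)).symm

/-- The latching map is isomorphic to `X ⊗ ∂Δ[n] ⟶ X ⊗ Δ[n]`. -/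
noncomputable def latchingMapArrowIso (X : SimplexCategory ⥤ C) (n : ℕ) :
    Arrow.mk (latchingMap X n) ≅ Arrow.mk (tensorMapRight X (bdryι.{v} n)) :=
  Arrow.isoMk (latchingIso X n) (tensorStdSimplexIso X n) (latchingIso_mapRight X n).symm

/-- The isomorphism between the sources of the relative latching map and of the horn map. -/
noncomputable def hornSourceIso {X Y : SimplexCategory ⥤ C} (φ : X ⟶ Y) (n : ℕ) :
    pushout (latchingMap X n) (latchingObjMap φ n) ≅
      pushout (tensorMapRight X (bdryι.{v} n)) (tensorMapLeft φ (bdry.{v} n)) :=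
  asIso (pushout.map _ _ _ _ (tensorStdSimplexIso X n).hom (latchingIso Y n).hom
    (latchingIso X n).hom (latchingIso_mapRight X n) (latchingIso_mapLeft φ n))

theorem hornSourceIso_hornMap {X Y : SimplexCategory ⥤ C} (φ : X ⟶ Y) (n : ℕ) :
    (hornSourceIso φ n).hom ≫ hornMap.{v} φ n =
      relativeLatchingMap φ n ≫ (tensorStdSimplexIso Y n).hom := by
  apply pushout.hom_ext
  · rw [relativeLatchingMap, pushout.inl_desc_assoc, tensorStdSimplexIso_mapLeft, hornSourceIso,
      asIso_hom, pushout.map, pushout.inl_desc_assoc, Category.assoc, hornMap, pushout.inl_desc]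
  · rw [relativeLatchingMap, pushout.inr_desc_assoc, latchingIso_mapRight, hornSourceIso,
      asIso_hom, pushout.map, pushout.inr_desc_assoc, Category.assoc, hornMap, pushout.inr_desc]

/-- The relative latching map is isomorphic to the horn map. -/
noncomputable def relativeLatchingMapArrowIso {X Y : SimplexCategory ⥤ C} (φ : X ⟶ Y) (n : ℕ) :
    Arrow.mk (relativeLatchingMap φ n) ≅ Arrow.mk (hornMap.{v} φ n) :=
  Arrow.isoMk (hornSourceIso φ n) (tensorStdSimplexIso Y n) (hornSourceIso_hornMap φ n)

end Comparison

/-! ### Consequences of Reedy cofibrancy -/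

section ModelCategory

variable {C : Type u} [Category.{v} C] [ModelCategory C]

theorem IsReedyCofibration.cofibration_hornMap {X Y : SimplexCategory ⥤ C} {φ : X ⟶ Y}
    (h : IsReedyCofibration φ) (n : ℕ) : Cofibration (hornMap.{v} φ n) := by
  rw [cofibration_iff, ← (cofibrations C).arrow_mk_iso_iff (relativeLatchingMapArrowIso φ n),
    ← cofibration_iff]
  exact h n

theorem IsReedyCofibrant.cofibration_mapRight_bdryι {X : SimplexCategory ⥤ C}
    (h : IsReedyCofibrant X) (n : ℕ) : Cofibration (tensorMapRight X (bdryι.{v} n)) := by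
  rw [cofibration_iff, ← (cofibrations C).arrow_mk_iso_iff (latchingMapArrowIso X n),
    ← cofibration_iff]
  exact h n

/-- Against boundary inclusions this is the adjoint of lifting the latching cofibrations against
`p`; boundary inclusions suffice. -/
theorem IsReedyCofibrant.rlp_monomorphisms_homSSetMap {X : SimplexCategory ⥤ C}
    (h : IsReedyCofibrant X) {E B : C} (p : E ⟶ B) [Fibration p] [WeakEquivalence p] :
    (MorphismProperty.monomorphisms SSet.{v}).rlp (homSSetMap X p) := by
  rw [SSet.rlp_monomorphisms]
  rintro _ _ _ ⟨n⟩
  have := h.cofibration_mapRight_bdryι n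
  rw [← hasLiftingProperty_tensorMapRight_iff]
  infer_instance

/-- Transposing back passes from boundary inclusions to arbitrary monomorphisms without any cell
decomposition in `C`. -/
theorem IsReedyCofibrant.cofibration_mapRight {X : SimplexCategory ⥤ C}
    (h : IsReedyCofibrant X) {K L : SSet.{v}} (i : K ⟶ L) [Mono i]
    [HasColimit (tensorDiagram X K)] [HasColimit (tensorDiagram X L)] :
    Cofibration (tensorMapRight X i) := by
  rw [cofibration_iff, ← trivialFibrations_llp]
  intro E B p hp
  rw [mem_trivialFibrations_iff] at hp
  obtain ⟨_, _⟩ := hp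
  rw [hasLiftingProperty_tensorMapRight_iff]
  exact h.rlp_monomorphisms_homSSetMap p _ (MorphismProperty.monomorphisms.infer_property i)

end ModelCategory

/-! ### Simplicial horn inclusions and Kan fibrations -/

section HornInclusions

variable {C : Type u} [Category.{v} C]

theorem isIso_tensorMapRight (X : SimplexCategory ⥤ C) {K L : SSet.{v}} (i : K ⟶ L) [IsIso i]
    [HasColimit (tensorDiagram X K)] [HasColimit (tensorDiagram X L)] :
    IsIso (tensorMapRight X i) :=
  ⟨tensorMapRight X (inv i), by rw [← tensorMapRight_comp, IsIso.hom_inv_id, tensorMapRight_id],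
    by rw [← tensorMapRight_comp, IsIso.inv_hom_id, tensorMapRight_id]⟩

variable [ModelCategory C]

/-- A cosimplicial object is homotopically constant if all its structure maps are weak
equivalences. -/
def IsHomotopicallyConstant (X : SimplexCategory ⥤ C) : Prop :=
  ∀ ⦃a b : SimplexCategory⦄ (f : a ⟶ b), WeakEquivalence (X.map f)

/-- Two out of three, applied to the levelwise weak equivalence to a constant functor. -/
theorem CosimplicialResolution.isHomotopicallyConstant {A : C} (R : CosimplicialResolution A) :
    IsHomotopicallyConstant R.obj := fun a b f => by
  have := R.isReedyWeakEquivalence a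
  have := R.isReedyWeakEquivalence b
  have h : R.obj.map f ≫ R.toConst.app b = R.toConst.app a :=
    (R.toConst.naturality f).trans (Category.comp_id _)
  exact weakEquivalence_of_postcomp_of_fac h

theorem IsHomotopicallyConstant.weakEquivalence_stdSimplex {X : SimplexCategory ⥤ C}
    (hX : IsHomotopicallyConstant X) {m n : ℕ} (f : (Δ[m] : SSet.{v}) ⟶ Δ[n]) :
    WeakEquivalence (tensorMapRight X f) := by
  obtain ⟨f, rfl⟩ := simplexFunctor.{v}.map_surjective (X := ⦋m⦌) (Y := ⦋n⦌) f
  have := hX f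
  exact weakEquivalence_of_precomp_of_fac (tensorStdSimplexIso_naturality X f).symm

theorem IsHomotopicallyConstant.weakEquivalence_of_iso {X : SimplexCategory ⥤ C}
    (hX : IsHomotopicallyConstant X) {m n : ℕ} {K L : SSet.{v}} (e : Δ[m] ≅ K) (e' : Δ[n] ≅ L)
    (f : K ⟶ L) [HasColimit (tensorDiagram X K)] [HasColimit (tensorDiagram X L)] :
    WeakEquivalence (tensorMapRight X f) := by
  have h : f = e.inv ≫ (e.hom ≫ f ≫ e'.inv) ≫ e'.hom := by simp
  have h1 := hX.weakEquivalence_stdSimplex (e.hom ≫ f ≫ e'.inv)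
  have h2 := isIso_tensorMapRight X e.inv
  have h3 := isIso_tensorMapRight X e'.hom
  rw [h, tensorMapRight_comp, tensorMapRight_comp]
  infer_instance

theorem exists_iso_face {n : ℕ} {S : Finset (Fin (n + 1))} (hS : S.Nonempty) :
    ∃ m : ℕ, Nonempty (Δ[m] ≅ (SSet.stdSimplex.face.{v} S : SSet.{v})) := by
  -- A face with `m + 1` vertices is an `m`-simplex.
  obtain ⟨m, hm⟩ := Nat.exists_eq_succ_of_ne_zero hS.card_pos.ne'
  exact ⟨m, ⟨SSet.stdSimplex.isoOfRepresentableBy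
    (SSet.stdSimplex.faceRepresentableBy _ _ (S.orderIsoOfFin hm))⟩⟩

theorem IsHomotopicallyConstant.weakEquivalence_face {X : SimplexCategory ⥤ C}
    (hX : IsHomotopicallyConstant X) {n : ℕ} {S T : Finset (Fin (n + 1))} (hS : S.Nonempty)
    (hST : S ⊆ T) :
    WeakEquivalence (tensorMapRight X (SSet.Subcomplex.homOfLE
      ((SSet.stdSimplex.face_le_face_iff.{v} S T).2 hST))) := by
  obtain ⟨m, ⟨e⟩⟩ := exists_iso_face.{v} hS
  obtain ⟨k, ⟨e'⟩⟩ := exists_iso_face.{v} (hS.mono hST)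
  exact hX.weakEquivalence_of_iso e e' _

/-- The union of the facets of `face S` opposite to the vertices in `I`. -/
def unionOfFacets {n : ℕ} (S I : Finset (Fin (n + 1))) : (Δ[n] : SSet.{v}).Subcomplex :=
  ⨆ i ∈ I, SSet.stdSimplex.face (S.erase i)

theorem unionOfFacets_insert {n : ℕ} (S I : Finset (Fin (n + 1))) (i : Fin (n + 1)) :
    unionOfFacets.{v} S (insert i I) = SSet.stdSimplex.face (S.erase i) ⊔ unionOfFacets S I :=
  Finset.iSup_insert _ _ _

/-- Intersecting with a facet gives again a union of the same kind, for the smaller vertex set; this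
drives the induction below. -/
theorem unionOfFacets_inf_face {n : ℕ} (S I : Finset (Fin (n + 1))) (i : Fin (n + 1)) :
    SSet.stdSimplex.face (S.erase i) ⊓ unionOfFacets.{v} S I = unionOfFacets (S.erase i) I := by
  have h (j : Fin (n + 1)) : SSet.stdSimplex.face.{v} (S.erase i) ⊓
      SSet.stdSimplex.face (S.erase j) = SSet.stdSimplex.face ((S.erase i).erase j) := by
    rw [SSet.stdSimplex.face_inter_face]
    congr 1
    ext k
    simp only [Finset.inf_eq_inter, Finset.mem_inter, Finset.mem_erase]
    tauto
  ext m x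
  simp [unionOfFacets, ← h]

theorem face_le_unionOfFacets {n : ℕ} {S I : Finset (Fin (n + 1))} {i : Fin (n + 1)}
    (hi : i ∈ I) : SSet.stdSimplex.face (S.erase i) ≤ unionOfFacets.{v} S I :=
  le_iSup₂_of_le i hi le_rfl

theorem face_singleton_le_unionOfFacets {n : ℕ} {S I : Finset (Fin (n + 1))} {k : Fin (n + 1)}
    (hk : k ∈ S) (hI : I.Nonempty) (hkI : k ∉ I) :
    SSet.stdSimplex.face {k} ≤ unionOfFacets.{v} S I := by
  obtain ⟨i, hi⟩ := hI
  refine le_trans ?_ (face_le_unionOfFacets hi)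
  rw [SSet.stdSimplex.face_le_face_iff]
  simp only [Finset.singleton_subset_iff, Finset.mem_erase]
  exact ⟨fun h => hkI (h ▸ hi), hk⟩

/-- `X ⊗ -` sends the inclusion of a vertex in a union of facets containing it to a weak
equivalence. -/
theorem weakEquivalence_unionOfFacets {X : SimplexCategory ⥤ C}
    (hX : IsHomotopicallyConstant X) (hX' : IsReedyCofibrant X) {n : ℕ} {k : Fin (n + 1)}
    {I : Finset (Fin (n + 1))} (hI : I.Nonempty) :
    ∀ {S : Finset (Fin (n + 1))} (hk : k ∈ S) (hkI : k ∉ I),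
      WeakEquivalence (tensorMapRight X (SSet.Subcomplex.homOfLE
        (face_singleton_le_unionOfFacets.{v} hk hI hkI))) := by
  -- `S` stays general, because the induction hypothesis is used for both `S` and `S.erase i`.
  induction hI using Finset.Nonempty.cons_induction with
  | singleton i =>
    intro S hk hkI
    have hki : k ∈ S.erase i := by simpa [hk] using hkI
    have h : unionOfFacets.{v} S {i} = SSet.stdSimplex.face (S.erase i) := by
      simp [unionOfFacets]
    obtain ⟨a, ⟨e⟩⟩ := exists_iso_face.{v} (Finset.singleton_nonempty k)
    obtain ⟨b, ⟨e'⟩⟩ := exists_iso_face.{v} ⟨k, hki⟩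
    exact hX.weakEquivalence_of_iso e (e' ≪≫ SSet.Subcomplex.eqToIso h.symm) _
  | cons i I hi hI ih =>
    intro S hk hkI
    have hki : k ∈ S.erase i := by
      simp only [Finset.mem_cons, not_or] at hkI
      simp [hk, hkI.1]
    have hkI' : k ∉ I := fun h => hkI (by simp [h])
    have h1 := ih hk hkI'
    have h2 := ih hki hkI'
    have h3 := hX.weakEquivalence_face (Finset.singleton_nonempty k)
      (Finset.singleton_subset_iff.2 hki)
    -- Adding the facet opposite to `i` is a pushout along its intersection with the previous
    -- facets.
    have sq : SSet.Subcomplex.BicartSq (unionOfFacets.{v} (S.erase i) I)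
        (SSet.stdSimplex.face (S.erase i)) (unionOfFacets.{v} S I)
        (unionOfFacets.{v} S (Finset.cons i I hi)) :=
      { sup_eq := by rw [Finset.cons_eq_insert, unionOfFacets_insert]
        inf_eq := unionOfFacets_inf_face S I i }
    -- The intersection and the facet are both compared with the vertex `k`.
    have h4 : WeakEquivalence (tensorMapRight X (SSet.Subcomplex.homOfLE sq.le₁₂)) := by
      rw [← SSet.Subcomplex.homOfLE_comp (face_singleton_le_unionOfFacets.{v} hki hI hkI')
        sq.le₁₂, tensorMapRight_comp] at h3
      exact weakEquivalence_of_precomp (tensorMapRight X (SSet.Subcomplex.homOfLE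
        (face_singleton_le_unionOfFacets.{v} hki hI hkI'))) _
    have h5 : Cofibration (tensorMapRight X (SSet.Subcomplex.homOfLE sq.le₁₂)) :=
      hX'.cofibration_mapRight _
    -- Trivial cofibrations are stable under pushout. The pushout is used in simplicial sets, on the
    -- other side of the adjunction.
    have h6 : trivialCofibrations C
        (tensorMapRight X (SSet.Subcomplex.homOfLE sq.le₃₄)) := by
      rw [← fibrations_llp]
      intro E B p hp
      rw [← fibration_iff] at hp
      rw [hasLiftingProperty_tensorMapRight_iff]
      have : HasLiftingProperty (SSet.Subcomplex.homOfLE sq.le₁₂) (homSSetMap X p) := by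
        rw [← hasLiftingProperty_tensorMapRight_iff]
        infer_instance
      exact sq.isPushout.flip.hasLiftingProperty _
    have h7 : WeakEquivalence (tensorMapRight X (SSet.Subcomplex.homOfLE sq.le₃₄)) :=
      (weakEquivalence_iff _).2 h6.2
    rw [← SSet.Subcomplex.homOfLE_comp (face_singleton_le_unionOfFacets.{v} hk hI hkI')
      sq.le₃₄, tensorMapRight_comp]
    infer_instance

theorem horn_eq_unionOfFacets (n : ℕ) (k : Fin (n + 1)) :
    SSet.horn.{v} n k = unionOfFacets Finset.univ (Finset.univ.erase k) := by
  rw [SSet.horn_eq_iSup, unionOfFacets, iSup_subtype]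
  refine iSup_congr fun i => ?_
  simp [Finset.compl_eq_univ_sdiff, Finset.sdiff_singleton_eq_erase]

/-- The inclusions of the vertex `k` in the horn and in the simplex both become weak equivalences,
so two out of three applies. -/
theorem weakEquivalence_mapRight_horn {X : SimplexCategory ⥤ C}
    (hX : IsHomotopicallyConstant X) (hX' : IsReedyCofibrant X) {n : ℕ} (k : Fin (n + 2)) :
    WeakEquivalence (tensorMapRight X (SSet.horn.{v} (n + 1) k).ι) := by
  have hI : (Finset.univ.erase k).Nonempty := by
    obtain ⟨i, hi⟩ := exists_ne k
    exact ⟨i, by simp [hi]⟩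
  have h1 := weakEquivalence_unionOfFacets hX hX' (k := k) hI (Finset.mem_univ k)
    (Finset.notMem_erase k _)
  have h := face_singleton_le_unionOfFacets.{v} (Finset.mem_univ k) hI (Finset.notMem_erase k _)
  rw [horn_eq_unionOfFacets]
  obtain ⟨a, ⟨e⟩⟩ := exists_iso_face.{v} (Finset.singleton_nonempty k)
  have h2 := hX.weakEquivalence_of_iso e (Iso.refl _) (SSet.stdSimplex.face {k}).ι
  rw [← SSet.Subcomplex.homOfLE_ι h, tensorMapRight_comp] at h2
  exact weakEquivalence_of_precomp (tensorMapRight X (SSet.Subcomplex.homOfLE h)) _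

open SSet.modelCategoryQuillen in
/-- For a homotopically constant Reedy cofibrant cosimplicial object `X`, the functor
`homSSet X` sends fibrations to Kan fibrations. -/
theorem fibration_homSSetMap {X : SimplexCategory ⥤ C}
    (hX : IsHomotopicallyConstant X) (hX' : IsReedyCofibrant X) {E B : C} (p : E ⟶ B)
    [Fibration p] : Fibration (homSSetMap X p) := by
  rw [SSet.modelCategoryQuillen.fibration_iff]
  intro _ _ _ hi
  simp only [J, MorphismProperty.iSup_iff] at hi
  obtain ⟨n, ⟨k⟩⟩ := hi
  have := weakEquivalence_mapRight_horn hX hX' k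
  have := hX'.cofibration_mapRight (SSet.horn.{v} (n + 1) k).ι
  rw [← hasLiftingProperty_tensorMapRight_iff]
  infer_instance

end HornInclusions

/-! ### Extension of homotopies in simplicial sets -/

section CylinderLifting

open MonoidalCategory SSet CartesianMonoidalCategory

/-- Maps on two subcomplexes which agree on the intersection glue on the union; the compatibility
with a map to a base is kept track of. -/
theorem exists_glue {T E B : SSet.{v}} (P Q : T.Subcomplex) (f : (P : SSet.{v}) ⟶ E)
    (g : (Q : SSet.{v}) ⟶ E)
    (hfg : ∀ (n : SimplexCategoryᵒᵖ) (x : T.obj n) (hP : x ∈ P.obj n) (hQ : x ∈ Q.obj n),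
      f.app n ⟨x, hP⟩ = g.app n ⟨x, hQ⟩)
    (q : E ⟶ B) (h : T ⟶ B) (hf : f ≫ q = P.ι ≫ h) (hg : g ≫ q = Q.ι ≫ h) :
    ∃ u : ((P ⊔ Q : T.Subcomplex) : SSet.{v}) ⟶ E, Subcomplex.homOfLE le_sup_left ≫ u = f ∧
      Subcomplex.homOfLE le_sup_right ≫ u = g ∧ u ≫ q = (P ⊔ Q).ι ≫ h := by
  have sq : Subcomplex.BicartSq (P ⊓ Q) P Q (P ⊔ Q) := { sup_eq := rfl, inf_eq := rfl }
  have w : Subcomplex.homOfLE sq.le₁₂ ≫ f = Subcomplex.homOfLE sq.le₁₃ ≫ g := by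
    ext n x
    exact hfg n x.1 x.2.1 x.2.2
  refine ⟨sq.isPushout.desc f g w, sq.isPushout.inl_desc _ _ _, sq.isPushout.inr_desc _ _ _, ?_⟩
  apply sq.isPushout.hom_ext
  · rw [sq.isPushout.inl_desc_assoc, hf]
    rfl
  · rw [sq.isPushout.inr_desc_assoc, hg]
    rfl

variable {L E B : SSet.{v}} (A : L.Subcomplex)

/-- The bottom `L ⊗ {0}` of the cylinder `L ⊗ Δ[1]` for `k = 0`, and its top for `k = 1`. -/
abbrev cylinderEnd (L : SSet.{v}) (k : Fin 2) : (L ⊗ Δ[1] : SSet.{v}).Subcomplex :=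
  (⊤ : L.Subcomplex).prod (stdSimplex.face {k})

/-- A simplex of `Δ[1]` is determined by its vertices, and here they are all `0`. -/
theorem eq_ι₀_of_mem_cylinderEnd {n : SimplexCategoryᵒᵖ} {x : (L ⊗ Δ[1] : SSet.{v}).obj n}
    (hx : x ∈ (cylinderEnd L 0).obj n) : x = ι₀.app n x.1 := by
  induction n using Opposite.rec with | _ n
  induction n using SimplexCategory.rec with | _ n
  have h : (x.2 : (Δ[1] : SSet.{v}) _⦋n⦌) = (ι₀.app (.op ⦋n⦌) x.1).2 := DFunLike.ext _ _ fun i =>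
    Finset.mem_singleton.1 ((stdSimplex.mem_face_iff _ _).1 hx.2 i)
  exact Prod.ext rfl h

theorem eq_ι₁_of_mem_cylinderEnd {n : SimplexCategoryᵒᵖ} {x : (L ⊗ Δ[1] : SSet.{v}).obj n}
    (hx : x ∈ (cylinderEnd L 1).obj n) : x = ι₁.app n x.1 := by
  induction n using Opposite.rec with | _ n
  induction n using SimplexCategory.rec with | _ n
  have h : (x.2 : (Δ[1] : SSet.{v}) _⦋n⦌) = (ι₁.app (.op ⦋n⦌) x.1).2 := DFunLike.ext _ _ fun i =>
    Finset.mem_singleton.1 ((stdSimplex.mem_face_iff _ _).1 hx.2 i)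
  exact Prod.ext rfl h

/-- Every simplex has an initial vertex, whose coordinate in `Δ[1]` cannot be both `0` and `1`. -/
theorem notMem_cylinderEnd_one {n : SimplexCategoryᵒᵖ} {x : (L ⊗ Δ[1] : SSet.{v}).obj n}
    (h₀ : x ∈ (cylinderEnd L 0).obj n) : x ∉ (cylinderEnd L 1).obj n := fun h₁ => by
  induction n using Opposite.rec with | _ n
  induction n using SimplexCategory.rec with | _ n
  have e₀ := Finset.mem_singleton.1 ((stdSimplex.mem_face_iff _ _).1 h₀.2 0)
  have e₁ := Finset.mem_singleton.1 ((stdSimplex.mem_face_iff _ _).1 h₁.2 0)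
  exact zero_ne_one (e₀.symm.trans e₁)

/-- The bottom of the cylinder as a map to the subcomplex `cylinderEnd L 0`. -/
noncomputable def toCylinderEnd₀ (L : SSet.{v}) : L ⟶ (cylinderEnd L 0 : SSet.{v}) :=
  Subcomplex.lift ι₀ (by
    rintro n _ ⟨x, rfl⟩
    induction n using Opposite.rec with | _ n
    induction n using SimplexCategory.rec with | _ n
    exact ⟨trivial, (stdSimplex.mem_face_iff _ _).2 fun i => Finset.mem_singleton.2 rfl⟩)

/-- The top of the cylinder as a map to the subcomplex `cylinderEnd L 1`. -/
noncomputable def toCylinderEnd₁ (L : SSet.{v}) : L ⟶ (cylinderEnd L 1 : SSet.{v}) :=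
  Subcomplex.lift ι₁ (by
    rintro n _ ⟨x, rfl⟩
    induction n using Opposite.rec with | _ n
    induction n using SimplexCategory.rec with | _ n
    exact ⟨trivial, (stdSimplex.mem_face_iff _ _).2 fun i => Finset.mem_singleton.2 rfl⟩)

/-- The isomorphism of the subcomplex `A ⊗ Δ[1]` of `L ⊗ Δ[1]` with the product. -/
noncomputable def prodTopIso : (A.prod (⊤ : (Δ[1] : SSet.{v}).Subcomplex) : SSet.{v}) ≅
    (A : SSet.{v}) ⊗ Δ[1] :=
  A.prodIso ⊤ ≪≫ whiskerLeftIso _ (Subcomplex.topIso _)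

theorem prodTopIso_hom_whiskerRight :
    (prodTopIso A).hom ≫ A.ι ▷ Δ[1] = (A.prod ⊤).ι := rfl

/-- The vertex `0` is the horn `Λ[1, 0]`, the facet opposite to `1`. -/
theorem anodyneExtensions_face_zero :
    anodyneExtensions (stdSimplex.face.{v} ({0} : Finset (Fin 2))).ι := by
  have h : Λ[1, 0] = stdSimplex.face.{v} ({0} : Finset (Fin 2)) := by
    rw [horn_eq_unionOfFacets, show Finset.univ.erase (0 : Fin 2) = {1} from rfl, unionOfFacets]
    exact Finset.iSup_singleton (1 : Fin 2) (fun i => stdSimplex.face (Finset.univ.erase i))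
  rw [← h]
  exact anodyneExtensions.horn_ι _

variable {A} {q : E ⟶ B} {f : (A : SSet.{v}) ⊗ Δ[1] ⟶ E} {g₀ g₁ : L ⟶ E}
  {h : L ⊗ Δ[1] ⟶ B}

/-- The overlap condition for gluing `g₀` on the bottom with the homotopy `f` on `A`. -/
theorem agree₀ (hf₀ : ι₀ ≫ f = A.ι ≫ g₀) (n : SimplexCategoryᵒᵖ)
    (x : (L ⊗ Δ[1] : SSet.{v}).obj n) (hP : x ∈ (cylinderEnd L 0).obj n)
    (hQ : x ∈ (A.prod ⊤).obj n) :
    ((cylinderEnd L 0).ι ≫ fst _ _ ≫ g₀).app n ⟨x, hP⟩ =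
      ((prodTopIso A).hom ≫ f).app n ⟨x, hQ⟩ := by
  have h1 := NatTrans.congr_app hf₀ n
  have h2 := ConcreteCategory.congr_hom h1 ⟨x.1, hQ.1⟩
  refine h2.symm.trans ?_
  refine congrArg (f.app n) (Prod.ext rfl ?_)
  exact (congrArg Prod.snd (eq_ι₀_of_mem_cylinderEnd hP)).symm

theorem agree₁ (hf₁ : ι₁ ≫ f = A.ι ≫ g₁) (n : SimplexCategoryᵒᵖ)
    (x : (L ⊗ Δ[1] : SSet.{v}).obj n) (hP : x ∈ (cylinderEnd L 1).obj n)
    (hQ : x ∈ (A.prod ⊤).obj n) :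
    ((cylinderEnd L 1).ι ≫ fst _ _ ≫ g₁).app n ⟨x, hP⟩ =
      ((prodTopIso A).hom ≫ f).app n ⟨x, hQ⟩ := by
  have h1 := NatTrans.congr_app hf₁ n
  have h2 := ConcreteCategory.congr_hom h1 ⟨x.1, hQ.1⟩
  refine h2.symm.trans ?_
  refine congrArg (f.app n) (Prod.ext rfl ?_)
  exact (congrArg Prod.snd (eq_ι₁_of_mem_cylinderEnd hP)).symm

/-- Extension of homotopies from a subcomplex with one prescribed end. -/
theorem exists_lift_cylinder_of_anodyne (hq : anodyneExtensions.rlp q)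
    (hf₀ : ι₀ ≫ f = A.ι ≫ g₀) (hf : f ≫ q = A.ι ▷ Δ[1] ≫ h) (hg₀ : g₀ ≫ q = ι₀ ≫ h) :
    ∃ l : L ⊗ Δ[1] ⟶ E, A.ι ▷ Δ[1] ≫ l = f ∧ ι₀ ≫ l = g₀ ∧ l ≫ q = h := by
  have e₀ : ((cylinderEnd L 0).ι ≫ fst _ _ ≫ g₀) ≫ q = (cylinderEnd L 0).ι ≫ h := by
    ext n x
    have := ConcreteCategory.congr_hom (NatTrans.congr_app hg₀ n) x.1.1
    refine this.trans ?_
    exact congrArg (h.app n) (eq_ι₀_of_mem_cylinderEnd x.2).symm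
  obtain ⟨u, hu₀, huA, hu⟩ := exists_glue (cylinderEnd L 0) (A.prod ⊤) _
    ((prodTopIso A).hom ≫ f) (agree₀ hf₀) q h e₀
    (by rw [Category.assoc, hf, ← prodTopIso_hom_whiskerRight, Category.assoc])
  -- The pushout-product of a monomorphism with an anodyne extension is anodyne.
  have : HasLiftingProperty (A.unionProd (stdSimplex.face {0})).ι q :=
    hq _ (anodyneExtensions_unionProd_ι A _ anodyneExtensions_face_zero)
  have sq : CommSq u (A.unionProd (stdSimplex.face {0})).ι q h := ⟨hu⟩
  obtain ⟨⟨l, hl, hlq⟩⟩ := (this.sq_hasLift sq).exists_lift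
  refine ⟨l, ?_, ?_, hlq⟩
  · rw [← cancel_epi (prodTopIso A).hom, ← huA, ← hl]
    rfl
  · have h1 : toCylinderEnd₀ L ≫ (cylinderEnd L 0).ι ≫ fst _ _ ≫ g₀ = g₀ := rfl
    rw [← h1, ← hu₀, ← hl]
    rfl

/-- Extension of homotopies from a subcomplex with two prescribed ends. -/
theorem exists_lift_cylinder (hq : (MorphismProperty.monomorphisms SSet.{v}).rlp q)
    (hf₀ : ι₀ ≫ f = A.ι ≫ g₀) (hf₁ : ι₁ ≫ f = A.ι ≫ g₁) (hf : f ≫ q = A.ι ▷ Δ[1] ≫ h)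
    (hg₀ : g₀ ≫ q = ι₀ ≫ h) (hg₁ : g₁ ≫ q = ι₁ ≫ h) :
    ∃ l : L ⊗ Δ[1] ⟶ E, A.ι ▷ Δ[1] ≫ l = f ∧ ι₀ ≫ l = g₀ ∧ ι₁ ≫ l = g₁ ∧ l ≫ q = h := by
  have e₀ : ((cylinderEnd L 0).ι ≫ fst _ _ ≫ g₀) ≫ q = (cylinderEnd L 0).ι ≫ h := by
    ext n x
    have := ConcreteCategory.congr_hom (NatTrans.congr_app hg₀ n) x.1.1
    exact this.trans (congrArg (h.app n) (eq_ι₀_of_mem_cylinderEnd x.2).symm)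
  have e₁ : ((cylinderEnd L 1).ι ≫ fst _ _ ≫ g₁) ≫ q = (cylinderEnd L 1).ι ≫ h := by
    ext n x
    have := ConcreteCategory.congr_hom (NatTrans.congr_app hg₁ n) x.1.1
    exact this.trans (congrArg (h.app n) (eq_ι₁_of_mem_cylinderEnd x.2).symm)
  -- The two disjoint ends are glued first, then the homotopy on `A` is added.
  obtain ⟨t, ht₀, ht₁, ht⟩ := exists_glue (cylinderEnd L 0) (cylinderEnd L 1) _ _ 
    (fun n x h₀ h₁ => (notMem_cylinderEnd_one h₀ h₁).elim) q h e₀ e₁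
  obtain ⟨u, hut, huA, hu⟩ := exists_glue (cylinderEnd L 0 ⊔ cylinderEnd L 1) (A.prod ⊤) t
    ((prodTopIso A).hom ≫ f) (by
      intro n x hP hQ
      obtain hP | hP := hP
      · rw [← agree₀ hf₀ n x hP hQ]
        exact ConcreteCategory.congr_hom (NatTrans.congr_app ht₀ n) ⟨x, hP⟩
      · rw [← agree₁ hf₁ n x hP hQ]
        exact ConcreteCategory.congr_hom (NatTrans.congr_app ht₁ n) ⟨x, hP⟩) q h ht
    (by rw [Category.assoc, hf, ← prodTopIso_hom_whiskerRight, Category.assoc])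
  have := hq _ (MorphismProperty.monomorphisms.infer_property
    ((cylinderEnd L 0 ⊔ cylinderEnd L 1) ⊔ A.prod ⊤).ι)
  have sq : CommSq u ((cylinderEnd L 0 ⊔ cylinderEnd L 1) ⊔ A.prod ⊤).ι q h := ⟨hu⟩
  obtain ⟨⟨l, hl, hlq⟩⟩ := (this.sq_hasLift sq).exists_lift
  refine ⟨l, ?_, ?_, ?_, hlq⟩
  · rw [← cancel_epi (prodTopIso A).hom, ← huA, ← hl]
    rfl
  · have h1 : toCylinderEnd₀ L ≫ (cylinderEnd L 0).ι ≫ fst _ _ ≫ g₀ = g₀ := rfl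
    rw [← h1, ← ht₀, ← hut, ← hl]
    rfl
  · have h1 : toCylinderEnd₁ L ≫ (cylinderEnd L 1).ι ≫ fst _ _ ≫ g₁ = g₁ := rfl
    rw [← h1, ← ht₁, ← hut, ← hl]
    rfl

end CylinderLifting

/-! ### The case of an empty subcomplex -/

section CylinderEnds

open MonoidalCategory SSet CartesianMonoidalCategory

variable {L E B : SSet.{v}} {q : E ⟶ B} {g₀ g₁ : L ⟶ E} {h : L ⊗ Δ[1] ⟶ B}

/-- Extension of homotopies with one prescribed end. -/
theorem exists_lift_cylinder_end (hq : anodyneExtensions.rlp q) (hg₀ : g₀ ≫ q = ι₀ ≫ h) :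
    ∃ l : L ⊗ Δ[1] ⟶ E, ι₀ ≫ l = g₀ ∧ l ≫ q = h := by
  obtain ⟨l, -, h₁, h₂⟩ := exists_lift_cylinder_of_anodyne
    (A := ⊥) (f := fst _ _ ≫ Subcomplex.isInitialBot.to E) hq
    (Subcomplex.isInitialBot.hom_ext _ _) (by ext n x; exact x.1.2.elim) hg₀
  exact ⟨l, h₁, h₂⟩

/-- Extension of homotopies with two prescribed ends. -/
theorem exists_lift_cylinder_ends (hq : (MorphismProperty.monomorphisms SSet.{v}).rlp q)
    (hg₀ : g₀ ≫ q = ι₀ ≫ h) (hg₁ : g₁ ≫ q = ι₁ ≫ h) :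
    ∃ l : L ⊗ Δ[1] ⟶ E, ι₀ ≫ l = g₀ ∧ ι₁ ≫ l = g₁ ∧ l ≫ q = h := by
  obtain ⟨l, -, h₁, h₂, h₃⟩ := exists_lift_cylinder
    (A := ⊥) (f := fst _ _ ≫ Subcomplex.isInitialBot.to E) hq
    (Subcomplex.isInitialBot.hom_ext _ _) (Subcomplex.isInitialBot.hom_ext _ _)
    (by ext n x; exact x.1.2.elim) hg₀ hg₁
  exact ⟨l, h₁, h₂, h₃⟩

end CylinderEnds

/-! ### Maps out of `(X ⊗ L) ⨿_{X ⊗ K} (Y ⊗ K)` -/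

section Corner

variable {C : Type u} [Category.{v} C] [HasFiniteColimits C] {X Y : SimplexCategory ⥤ C}
  (φ : X ⟶ Y) {K L : SSet.{v}} (i : K ⟶ L) [HasColimit (tensorDiagram X K)]
  [HasColimit (tensorDiagram X L)] [HasColimit (tensorDiagram Y K)]

/-- The object `(X ⊗ L) ⨿_{X ⊗ K} (Y ⊗ K)`. -/
noncomputable abbrev cornerObj : C := pushout (tensorMapRight X i) (tensorMapLeft φ K)

variable {φ i}

/-- The component `L ⟶ homSSet X Z` of a map from `cornerObj φ i`. -/
noncomputable def cornerFst {Z : C} (g : cornerObj φ i ⟶ Z) : L ⟶ homSSet X Z :=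
  tensorEquiv X L Z (pushout.inl _ _ ≫ g)

/-- The component `K ⟶ homSSet Y Z` of a map from `cornerObj φ i`. -/
noncomputable def cornerSnd {Z : C} (g : cornerObj φ i ⟶ Z) : K ⟶ homSSet Y Z :=
  tensorEquiv Y K Z (pushout.inr _ _ ≫ g)

/-- The pushout condition, transposed: this is the only relation between the two components of a
map. -/
theorem cornerFst_cornerSnd {Z : C} (g : cornerObj φ i ⟶ Z) :
    i ≫ cornerFst g = cornerSnd g ≫ homSSetPre φ Z := by
  rw [cornerFst, cornerSnd, ← tensorEquiv_mapRight, ← tensorEquiv_mapLeft,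
    pushout.condition_assoc]

theorem corner_hom_ext {Z : C} {g g' : cornerObj φ i ⟶ Z} (h₁ : cornerFst g = cornerFst g')
    (h₂ : cornerSnd g = cornerSnd g') : g = g' :=
  pushout.hom_ext ((tensorEquiv X L Z).injective h₁) ((tensorEquiv Y K Z).injective h₂)

theorem cornerFst_comp {Z Z' : C} (g : cornerObj φ i ⟶ Z) (p : Z ⟶ Z') :
    cornerFst (g ≫ p) = cornerFst g ≫ homSSetMap X p := by
  rw [cornerFst, cornerFst, ← tensorEquiv_comp, Category.assoc]

theorem cornerSnd_comp {Z Z' : C} (g : cornerObj φ i ⟶ Z) (p : Z ⟶ Z') :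
    cornerSnd (g ≫ p) = cornerSnd g ≫ homSSetMap Y p := by
  rw [cornerSnd, cornerSnd, ← tensorEquiv_comp, Category.assoc]

/-- The map from `cornerObj φ i` with given components. -/
noncomputable def cornerDesc {Z : C} (a : L ⟶ homSSet X Z) (b : K ⟶ homSSet Y Z)
    (w : i ≫ a = b ≫ homSSetPre φ Z) : cornerObj φ i ⟶ Z :=
  pushout.desc ((tensorEquiv X L Z).symm a) ((tensorEquiv Y K Z).symm b)
    (by rw [mapRight_tensorEquiv_symm, mapLeft_tensorEquiv_symm, w])

theorem cornerFst_desc {Z : C} (a : L ⟶ homSSet X Z) (b : K ⟶ homSSet Y Z)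
    (w : i ≫ a = b ≫ homSSetPre φ Z) : cornerFst (cornerDesc a b w) = a := by
  rw [cornerFst, cornerDesc, pushout.inl_desc, Equiv.apply_symm_apply]

theorem cornerSnd_desc {Z : C} (a : L ⟶ homSSet X Z) (b : K ⟶ homSSet Y Z)
    (w : i ≫ a = b ≫ homSSetPre φ Z) : cornerSnd (cornerDesc a b w) = b := by
  rw [cornerSnd, cornerDesc, pushout.inr_desc, Equiv.apply_symm_apply]

section Functoriality

variable {K' L' : SSet.{v}} {i' : K' ⟶ L'} [HasColimit (tensorDiagram X K')]
  [HasColimit (tensorDiagram X L')] [HasColimit (tensorDiagram Y K')]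

variable (φ) in
/-- Functoriality of `cornerObj φ i` in `i`. -/
noncomputable def cornerMapRight (α : K ⟶ K') (β : L ⟶ L') (w : i ≫ β = α ≫ i') :
    cornerObj φ i ⟶ cornerObj φ i' :=
  pushout.map _ _ _ _ (tensorMapRight X β) (tensorMapRight Y α) (tensorMapRight X α)
    (by rw [← tensorMapRight_comp, w, tensorMapRight_comp]) (tensorMap_comm φ α).symm

theorem cornerFst_mapRight (α : K ⟶ K') (β : L ⟶ L') (w : i ≫ β = α ≫ i') {Z : C}
    (g : cornerObj φ i' ⟶ Z) : cornerFst (cornerMapRight φ α β w ≫ g) = β ≫ cornerFst g := by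
  rw [cornerFst, cornerFst, ← tensorEquiv_mapRight, cornerMapRight, pushout.map,
    pushout.inl_desc_assoc, Category.assoc]

theorem cornerSnd_mapRight (α : K ⟶ K') (β : L ⟶ L') (w : i ≫ β = α ≫ i') {Z : C}
    (g : cornerObj φ i' ⟶ Z) : cornerSnd (cornerMapRight φ α β w ≫ g) = α ≫ cornerSnd g := by
  rw [cornerSnd, cornerSnd, ← tensorEquiv_mapRight, cornerMapRight, pushout.map,
    pushout.inr_desc_assoc, Category.assoc]

theorem cornerMapRight_comp_eq_id {α : K ⟶ K'} {β : L ⟶ L'} (w : i ≫ β = α ≫ i')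
    {α' : K' ⟶ K} {β' : L' ⟶ L} (w' : i' ≫ β' = α' ≫ i) (hα : α ≫ α' = 𝟙 K)
    (hβ : β ≫ β' = 𝟙 L) : cornerMapRight φ α β w ≫ cornerMapRight φ α' β' w' = 𝟙 _ := by
  apply corner_hom_ext
  · rw [cornerFst_mapRight, ← Category.comp_id (cornerMapRight φ α' β' w'), cornerFst_mapRight,
      reassoc_of% hβ]
  · rw [cornerSnd_mapRight, ← Category.comp_id (cornerMapRight φ α' β' w'), cornerSnd_mapRight,
      reassoc_of% hα]

end Functoriality

variable [HasColimit (tensorDiagram Y L)]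

variable (φ i) in
/-- The map `(X ⊗ L) ⨿_{X ⊗ K} (Y ⊗ K) ⟶ Y ⊗ L`. -/
noncomputable def cornerTo : cornerObj φ i ⟶ tensorObj Y L :=
  pushout.desc (tensorMapLeft φ L) (tensorMapRight Y i) (tensorMap_comm φ i)

theorem cornerFst_cornerTo {Z : C} (g : tensorObj Y L ⟶ Z) :
    cornerFst (cornerTo φ i ≫ g) = tensorEquiv Y L Z g ≫ homSSetPre φ Z := by
  rw [cornerFst, cornerTo, pushout.inl_desc_assoc, tensorEquiv_mapLeft]

theorem cornerSnd_cornerTo {Z : C} (g : tensorObj Y L ⟶ Z) :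
    cornerSnd (cornerTo φ i ≫ g) = i ≫ tensorEquiv Y L Z g := by
  rw [cornerSnd, cornerTo, pushout.inr_desc_assoc, tensorEquiv_mapRight]

theorem cornerMapRight_cornerTo {K' L' : SSet.{v}} {i' : K' ⟶ L'}
    [HasColimit (tensorDiagram X K')] [HasColimit (tensorDiagram X L')]
    [HasColimit (tensorDiagram Y K')] [HasColimit (tensorDiagram Y L')]
    (α : K ⟶ K') (β : L ⟶ L') (w : i ≫ β = α ≫ i') :
    cornerMapRight φ α β w ≫ cornerTo φ i' = cornerTo φ i ≫ tensorMapRight Y β := by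
  apply corner_hom_ext
  · rw [cornerFst_mapRight, ← Category.comp_id (cornerTo φ i'), cornerFst_cornerTo,
      cornerFst_cornerTo, ← Category.comp_id (tensorMapRight Y β), tensorEquiv_mapRight,
      Category.assoc]
  · rw [cornerSnd_mapRight, ← Category.comp_id (cornerTo φ i'), cornerSnd_cornerTo,
      cornerSnd_cornerTo, ← Category.comp_id (tensorMapRight Y β), tensorEquiv_mapRight,
      reassoc_of% w]

end Corner

/-! ### The prism cylinders of source and target of a horn -/

section PrismCylinders

open MonoidalCategory SSet CartesianMonoidalCategory

instance nonsingular_subcomplex_tensor {L : SSet.{v}} [(L ⊗ Δ[1] : SSet.{v}).Nonsingular]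
    (A : L.Subcomplex) : ((A : SSet.{v}) ⊗ Δ[1]).Nonsingular :=
  Nonsingular.of_iso (prodTopIso A)

variable {C : Type u} [Category.{v} C] [ModelCategory C] {X Y : SimplexCategory ⥤ C}

section Target

variable (Y) (L : SSet.{v}) [L.Finite] [L.Nonsingular] [(L ⊗ Δ[1] : SSet.{v}).Nonsingular]

/-- The cylinder `Y ⊗ (L ⊗ Δ[1])` of `Y ⊗ L`. -/
noncomputable def tensorPrecylinder : Precylinder (tensorObj Y L) where
  I := tensorObj Y (L ⊗ Δ[1] : SSet.{v})
  i₀ := tensorMapRight Y ι₀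
  i₁ := tensorMapRight Y ι₁
  π := tensorMapRight Y (fst _ _)
  i₀_π := by rw [← tensorMapRight_comp, ι₀_fst, tensorMapRight_id]
  i₁_π := by rw [← tensorMapRight_comp, ι₁_fst, tensorMapRight_id]

variable {Y L}

/-- This expresses that the inclusion of both ends is a cofibration, in a form that transfers to
slices without mentioning the coproduct. -/
theorem exists_lift_tensorPrecylinder (hY : IsReedyCofibrant Y) {E B : C} (p : E ⟶ B)
    [Fibration p] [WeakEquivalence p] {g₀ g₁ : tensorObj Y L ⟶ E}
    {h : (tensorPrecylinder Y L).I ⟶ B} (h₀ : g₀ ≫ p = (tensorPrecylinder Y L).i₀ ≫ h)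
    (h₁ : g₁ ≫ p = (tensorPrecylinder Y L).i₁ ≫ h) :
    ∃ l, (tensorPrecylinder Y L).i₀ ≫ l = g₀ ∧ (tensorPrecylinder Y L).i₁ ≫ l = g₁ ∧
      l ≫ p = h := by
  dsimp only [tensorPrecylinder] at h h₀ h₁ ⊢
  obtain ⟨l, e₀, e₁, e⟩ := exists_lift_cylinder_ends (hY.rlp_monomorphisms_homSSetMap p)
    (g₀ := tensorEquiv Y L E g₀) (g₁ := tensorEquiv Y L E g₁) (h := tensorEquiv Y _ B h)
    (by rw [← tensorEquiv_comp, ← tensorEquiv_mapRight, h₀])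
    (by rw [← tensorEquiv_comp, ← tensorEquiv_mapRight, h₁])
  refine ⟨(tensorEquiv Y _ E).symm l, ?_, ?_, ?_⟩
  · rw [mapRight_tensorEquiv_symm, e₀, Equiv.symm_apply_apply]
  · rw [mapRight_tensorEquiv_symm, e₁, Equiv.symm_apply_apply]
  · rw [tensorEquiv_symm_comp, e, Equiv.symm_apply_apply]

theorem rlp_anodyneExtensions_homSSetMap (hY : IsReedyCofibrant Y)
    (hY' : IsHomotopicallyConstant Y) {E B : C} (p : E ⟶ B) [Fibration p] :
    anodyneExtensions.rlp (homSSetMap Y p) := fun _ _ _ hi =>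
  hi _ ((SSet.modelCategoryQuillen.fibration_iff _).1 (fibration_homSSetMap hY' hY p))

/-- The bottom inclusion lifts against all fibrations, hence is a trivial cofibration, and the
projection is a retraction of it. -/
theorem weakEquivalence_tensorPrecylinder_π (hY : IsReedyCofibrant Y)
    (hY' : IsHomotopicallyConstant Y) : WeakEquivalence (tensorPrecylinder Y L).π := by
  have h : trivialCofibrations C (tensorPrecylinder Y L).i₀ := by
    rw [← fibrations_llp]
    intro E B p hp
    rw [← fibration_iff] at hp
    refine (hasLiftingProperty_tensorMapRight_iff _ _ _).2 ⟨fun {f g} sq => ?_⟩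
    obtain ⟨l, e₀, e⟩ := exists_lift_cylinder_end
      (rlp_anodyneExtensions_homSSetMap hY hY' p) sq.w
    exact ⟨⟨l, e₀, e⟩⟩
  have : WeakEquivalence (tensorPrecylinder Y L).i₀ := (weakEquivalence_iff _).2 h.2
  exact weakEquivalence_of_precomp_of_fac (tensorPrecylinder Y L).i₀_π

end Target

section Source

variable (φ : X ⟶ Y) {L : SSet.{v}} [L.Finite] [L.Nonsingular]
  [(L ⊗ Δ[1] : SSet.{v}).Nonsingular] (A : L.Subcomplex)

/-- The cylinder of `(X ⊗ L) ⨿_{X ⊗ A} (Y ⊗ A)`. -/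
noncomputable def cornerPrecylinder : Precylinder (cornerObj φ A.ι) where
  I := cornerObj φ (A.ι ▷ Δ[1])
  i₀ := cornerMapRight φ ι₀ ι₀ (by rw [ι₀_comp])
  i₁ := cornerMapRight φ ι₁ ι₁ (by rw [ι₁_comp])
  π := cornerMapRight φ (fst _ _) (fst _ _) rfl
  i₀_π := cornerMapRight_comp_eq_id _ _ (ι₀_fst _) (ι₀_fst _)
  i₁_π := cornerMapRight_comp_eq_id _ _ (ι₁_fst _) (ι₁_fst _)

theorem cornerPrecylinder_i₀_cornerTo : (cornerPrecylinder φ A).i₀ ≫ cornerTo φ (A.ι ▷ Δ[1]) =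
    cornerTo φ A.ι ≫ (tensorPrecylinder Y L).i₀ :=
  cornerMapRight_cornerTo _ _ (by rw [ι₀_comp])

theorem cornerPrecylinder_i₁_cornerTo : (cornerPrecylinder φ A).i₁ ≫ cornerTo φ (A.ι ▷ Δ[1]) =
    cornerTo φ A.ι ≫ (tensorPrecylinder Y L).i₁ :=
  cornerMapRight_cornerTo _ _ (by rw [ι₁_comp])

theorem cornerTo_tensorPrecylinder_π : cornerTo φ (A.ι ▷ Δ[1]) ≫ (tensorPrecylinder Y L).π =
    (cornerPrecylinder φ A).π ≫ cornerTo φ A.ι :=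
  (cornerMapRight_cornerTo (φ := φ) (i := A.ι ▷ Δ[1]) (i' := A.ι) (fst _ _) (fst _ _) rfl).symm

variable {φ A}

theorem exists_lift_cornerPrecylinder (hX : IsReedyCofibrant X) (hY : IsReedyCofibrant Y)
    {E B : C} (p : E ⟶ B) [Fibration p] [WeakEquivalence p] {g₀ g₁ : cornerObj φ A.ι ⟶ E}
    {h : (cornerPrecylinder φ A).I ⟶ B} (h₀ : g₀ ≫ p = (cornerPrecylinder φ A).i₀ ≫ h)
    (h₁ : g₁ ≫ p = (cornerPrecylinder φ A).i₁ ≫ h) :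
    ∃ l, (cornerPrecylinder φ A).i₀ ≫ l = g₀ ∧ (cornerPrecylinder φ A).i₁ ≫ l = g₁ ∧
      l ≫ p = h := by
  dsimp only [cornerPrecylinder] at h h₀ h₁ ⊢
  obtain ⟨b, b₀, b₁, hb⟩ := exists_lift_cylinder_ends (hY.rlp_monomorphisms_homSSetMap p)
    (g₀ := cornerSnd g₀) (g₁ := cornerSnd g₁) (h := cornerSnd h)
    (by rw [← cornerSnd_comp, h₀, cornerSnd_mapRight])
    (by rw [← cornerSnd_comp, h₁, cornerSnd_mapRight])
  -- The `Y`-component is lifted first; restricted along `φ`, it prescribes the `X`-component on `A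
  -- ⊗ Δ[1]`, which is then extended to `L ⊗ Δ[1]`.
  obtain ⟨a, ab, a₀, a₁, ha⟩ := exists_lift_cylinder (A := A)
    (hX.rlp_monomorphisms_homSSetMap p) (f := b ≫ homSSetPre φ E)
    (g₀ := cornerFst g₀) (g₁ := cornerFst g₁) (h := cornerFst h)
    (by rw [reassoc_of% b₀, cornerFst_cornerSnd])
    (by rw [reassoc_of% b₁, cornerFst_cornerSnd])
    (by rw [Category.assoc, ← homSSetMap_pre, reassoc_of% hb, cornerFst_cornerSnd])
    (by rw [← cornerFst_comp, h₀, cornerFst_mapRight])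
    (by rw [← cornerFst_comp, h₁, cornerFst_mapRight])
  refine ⟨cornerDesc a b ab, ?_, ?_, ?_⟩ <;> apply corner_hom_ext
  · rw [cornerFst_mapRight, cornerFst_desc, a₀]
  · rw [cornerSnd_mapRight, cornerSnd_desc, b₀]
  · rw [cornerFst_mapRight, cornerFst_desc, a₁]
  · rw [cornerSnd_mapRight, cornerSnd_desc, b₁]
  · rw [cornerFst_comp, cornerFst_desc, ha]
  · rw [cornerSnd_comp, cornerSnd_desc, hb]

theorem weakEquivalence_cornerPrecylinder_π (hX : IsReedyCofibrant X)
    (hX' : IsHomotopicallyConstant X) (hY : IsReedyCofibrant Y)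
    (hY' : IsHomotopicallyConstant Y) : WeakEquivalence (cornerPrecylinder φ A).π := by
  have h : trivialCofibrations C (cornerPrecylinder φ A).i₀ := by
    rw [← fibrations_llp]
    intro E B p hp
    rw [← fibration_iff] at hp
    refine ⟨fun {g₀ h} sq => ?_⟩
    have h₀ := sq.w
    dsimp only [cornerPrecylinder] at h h₀ ⊢
    obtain ⟨b, b₀, hb⟩ := exists_lift_cylinder_end (rlp_anodyneExtensions_homSSetMap hY hY' p)
      (g₀ := cornerSnd g₀) (h := cornerSnd h)
      (by rw [← cornerSnd_comp, h₀, cornerSnd_mapRight])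
    -- The same order as for two ends: the lifted `Y`-component fixes the `X`-component over `A`.
    obtain ⟨a, ab, a₀, ha⟩ := exists_lift_cylinder_of_anodyne (A := A)
      (rlp_anodyneExtensions_homSSetMap hX hX' p) (f := b ≫ homSSetPre φ E)
      (g₀ := cornerFst g₀) (h := cornerFst h)
      (by rw [reassoc_of% b₀, cornerFst_cornerSnd])
      (by rw [Category.assoc, ← homSSetMap_pre, reassoc_of% hb, cornerFst_cornerSnd])
      (by rw [← cornerFst_comp, h₀, cornerFst_mapRight])
    refine ⟨⟨⟨cornerDesc a b ab, ?_, ?_⟩⟩⟩ <;> apply corner_hom_ext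
    · rw [cornerFst_mapRight, cornerFst_desc, a₀]
    · rw [cornerSnd_mapRight, cornerSnd_desc, b₀]
    · rw [cornerFst_comp, cornerFst_desc, ha]
    · rw [cornerSnd_comp, cornerSnd_desc, hb]
  have : WeakEquivalence (cornerPrecylinder φ A).i₀ := (weakEquivalence_iff _).2 h.2
  exact weakEquivalence_of_precomp_of_fac (cornerPrecylinder φ A).i₀_π

/-- The lifting property of the map
`C(U) ⨿_{U ⨿ U} (V ⨿ V) ⟶ C(V)` for the cylinders above. -/
theorem exists_lift_cornerTo {E B : C} (p : E ⟶ B) (hp : ∀ n, HasLiftingProperty (hornMap φ n) p)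
    {f : (cornerPrecylinder φ A).I ⟶ E} {g₀ g₁ : tensorObj Y L ⟶ E}
    {h : (tensorPrecylinder Y L).I ⟶ B}
    (hf₀ : (cornerPrecylinder φ A).i₀ ≫ f = cornerTo φ A.ι ≫ g₀)
    (hf₁ : (cornerPrecylinder φ A).i₁ ≫ f = cornerTo φ A.ι ≫ g₁)
    (hf : f ≫ p = cornerTo φ (A.ι ▷ Δ[1]) ≫ h)
    (h₀ : g₀ ≫ p = (tensorPrecylinder Y L).i₀ ≫ h)
    (h₁ : g₁ ≫ p = (tensorPrecylinder Y L).i₁ ≫ h) :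
    ∃ l, cornerTo φ (A.ι ▷ Δ[1]) ≫ l = f ∧ (tensorPrecylinder Y L).i₀ ≫ l = g₀ ∧
      (tensorPrecylinder Y L).i₁ ≫ l = g₁ ∧ l ≫ p = h := by
  dsimp only [cornerPrecylinder, tensorPrecylinder] at f h hf₀ hf₁ hf h₀ h₁ ⊢
  have k₀ : homSSetPre φ E = homCorner φ p ≫ pullback.fst _ _ := (pullback.lift_fst _ _ _).symm
  have k₁ : homSSetMap Y p = homCorner φ p ≫ pullback.snd _ _ := (pullback.lift_snd _ _ _).symm
  have e₀ : ι₀ ≫ cornerSnd f = A.ι ≫ tensorEquiv Y L E g₀ := by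
    rw [← cornerSnd_cornerTo, ← hf₀, cornerSnd_mapRight]
  have e₁ : ι₁ ≫ cornerSnd f = A.ι ≫ tensorEquiv Y L E g₁ := by
    rw [← cornerSnd_cornerTo, ← hf₁, cornerSnd_mapRight]
  have a₀ : tensorEquiv Y L E g₀ ≫ homSSetPre φ E = ι₀ ≫ cornerFst f := by
    rw [← cornerFst_cornerTo (i := A.ι), ← hf₀, cornerFst_mapRight]
  have a₁ : tensorEquiv Y L E g₁ ≫ homSSetPre φ E = ι₁ ≫ cornerFst f := by
    rw [← cornerFst_cornerTo (i := A.ι), ← hf₁, cornerFst_mapRight]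
  have w : cornerFst f ≫ homSSetMap X p = tensorEquiv Y (L ⊗ Δ[1]) B h ≫ homSSetPre φ B := by
    rw [← cornerFst_comp, hf, cornerFst_cornerTo]
  -- The `Y`-component of `f` is a homotopy on `A`, `g₀` and `g₁` are its prescribed ends on `L`,
  -- and the `X`-component of `f` together with `h` gives the target homotopy in the pullback.
  obtain ⟨l, e, e₀, e₁, el⟩ := exists_lift_cylinder (A := A)
    (rlp_monomorphisms_homCorner φ p hp) (f := cornerSnd f)
    (g₀ := tensorEquiv Y L E g₀) (g₁ := tensorEquiv Y L E g₁)
    (h := pullback.lift _ _ w)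
    e₀
    e₁
    (by
      apply pullback.hom_ext
      · rw [Category.assoc, ← k₀, Category.assoc, pullback.lift_fst, cornerFst_cornerSnd]
      · rw [Category.assoc, ← k₁, Category.assoc, pullback.lift_snd, ← cornerSnd_comp, hf,
          cornerSnd_cornerTo])
    (by
      apply pullback.hom_ext
      · rw [Category.assoc, ← k₀, Category.assoc, pullback.lift_fst, a₀]
      · rw [Category.assoc, ← k₁, Category.assoc, pullback.lift_snd, ← tensorEquiv_comp, h₀,
          tensorEquiv_mapRight])
    (by
      apply pullback.hom_ext
      · rw [Category.assoc, ← k₀, Category.assoc, pullback.lift_fst, a₁]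
      · rw [Category.assoc, ← k₁, Category.assoc, pullback.lift_snd, ← tensorEquiv_comp, h₁,
          tensorEquiv_mapRight])
  have el₀ : l ≫ homSSetPre φ E = cornerFst f := by
    rw [k₀, ← Category.assoc, el, pullback.lift_fst]
  have el₁ : l ≫ homSSetMap Y p = tensorEquiv Y (L ⊗ Δ[1]) B h := by
    rw [k₁, ← Category.assoc, el, pullback.lift_snd]
  refine ⟨(tensorEquiv Y _ E).symm l, ?_, ?_, ?_, ?_⟩
  · apply corner_hom_ext
    · rw [cornerFst_cornerTo, Equiv.apply_symm_apply, el₀]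
    · rw [cornerSnd_cornerTo, Equiv.apply_symm_apply, e]
  · rw [mapRight_tensorEquiv_symm, e₀, Equiv.symm_apply_apply]
  · rw [mapRight_tensorEquiv_symm, e₁, Equiv.symm_apply_apply]
  · rw [tensorEquiv_symm_comp, el₁, Equiv.symm_apply_apply]

end Source

end PrismCylinders

/-! ### Transfer of cylinders to slice categories -/

section OverCylinders

variable {C : Type u} [Category.{v} C] [ModelCategory C] {Γ : C}

section

variable {U V : Over Γ}

/-- A criterion for goodness of cylinders in slice categories. -/
theorem isGood_of_exists_lift {P : Cylinder U}
    (H : ∀ ⦃E B : C⦄ (p : E ⟶ B) [Fibration p] [WeakEquivalence p] (g₀ g₁ : U.left ⟶ E)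
      (h : P.I.left ⟶ B), g₀ ≫ p = P.i₀.left ≫ h → g₁ ≫ p = P.i₁.left ≫ h →
        ∃ l, P.i₀.left ≫ l = g₀ ∧ P.i₁.left ≫ l = g₁ ∧ l ≫ p = h) : P.IsGood where
  cofibration_i := by
    rw [cofibration_iff, ← trivialFibrations_llp]
    intro E B p hp
    rw [mem_trivialFibrations_iff] at hp
    have := hp.1
    have := hp.2
    refine ⟨fun {g b} sq => ?_⟩
    have w₀ : (coprod.inl ≫ g) ≫ p = P.i₀ ≫ b := by
      rw [Category.assoc, sq.w, Precylinder.inl_i_assoc]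
    have w₁ : (coprod.inr ≫ g) ≫ p = P.i₁ ≫ b := by
      rw [Category.assoc, sq.w, Precylinder.inr_i_assoc]
    obtain ⟨l, l₀, l₁, hl⟩ := H p.left (coprod.inl ≫ g).left (coprod.inr ≫ g).left b.left
      (congrArg CommaMorphism.left w₀) (congrArg CommaMorphism.left w₁)
    refine ⟨⟨⟨Over.homMk l ?_, ?_, ?_⟩⟩⟩
    · rw [← Over.w p, reassoc_of% hl, Over.w b]
    · apply coprod.hom_ext
      · rw [Precylinder.inl_i_assoc]
        ext
        exact l₀
      · rw [Precylinder.inr_i_assoc]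
        ext
        exact l₁
    · ext
      exact hl

/-- A map out of the iterated pushout is a triple `f`, `g₀`, `g₁`, and lifting against the map to
the terminal object of the slice amounts to lifting the structure map of `Q.I` through `E.hom`. -/
theorem CylinderMap.hasLiftingProperty_cornerMap {i : U ⟶ V} {P : Cylinder U} {Q : Cylinder V}
    (c : CylinderMap i P Q) (E : Over Γ)
    (H : ∀ (f : P.I.left ⟶ E.left) (g₀ g₁ : V.left ⟶ E.left),
      P.i₀.left ≫ f = i.left ≫ g₀ → P.i₁.left ≫ f = i.left ≫ g₁ →
      f ≫ E.hom = c.hom.left ≫ Q.I.hom → g₀ ≫ E.hom = Q.i₀.left ≫ Q.I.hom →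
      g₁ ≫ E.hom = Q.i₁.left ≫ Q.I.hom →
        ∃ l, c.hom.left ≫ l = f ∧ Q.i₀.left ≫ l = g₀ ∧ Q.i₁.left ≫ l = g₁ ∧
          l ≫ E.hom = Q.I.hom) :
    HasLiftingProperty c.cornerMap (terminal.from E) := by
  refine ⟨fun {g b} sq => ?_⟩
  have w₀ : P.i₀ ≫ pushout.inl _ _ ≫ g = i ≫ coprod.inl ≫ pushout.inr _ _ ≫ g := by
    rw [← P.inl_i, Category.assoc, pushout.condition_assoc, coprod.inl_map_assoc]
  have w₁ : P.i₁ ≫ pushout.inl _ _ ≫ g = i ≫ coprod.inr ≫ pushout.inr _ _ ≫ g := by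
    rw [← P.inr_i, Category.assoc, pushout.condition_assoc, coprod.inr_map_assoc]
  obtain ⟨l, hl, l₀, l₁, hE⟩ := H (pushout.inl _ _ ≫ g).left
    (coprod.inl ≫ pushout.inr _ _ ≫ g).left (coprod.inr ≫ pushout.inr _ _ ≫ g).left
    (congrArg CommaMorphism.left w₀) (congrArg CommaMorphism.left w₁)
    (by rw [Over.w, Over.w]) (by rw [Over.w, Over.w]) (by rw [Over.w, Over.w])
  refine ⟨⟨⟨Over.homMk l hE, ?_, terminal.hom_ext _ _⟩⟩⟩
  apply pushout.hom_ext
  · rw [CylinderMap.cornerMap, pushout.inl_desc_assoc]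
    ext
    exact hl
  · rw [CylinderMap.cornerMap, pushout.inr_desc_assoc]
    apply coprod.hom_ext
    · rw [Precylinder.inl_i_assoc]
      ext
      exact l₀
    · rw [Precylinder.inr_i_assoc]
      ext
      exact l₁

end

section

variable {U V : Over Γ} {U₀ V₀ : C} (eU : U.left ≅ U₀) (eV : V.left ≅ V₀) (P : Precylinder U₀)
  (Q : Precylinder V₀) [WeakEquivalence P.π] [WeakEquivalence Q.π] {i : U ⟶ V} {i₀ : U₀ ⟶ V₀}

/-- A cylinder of an object of `C` is a cylinder in every slice category. -/
noncomputable abbrev overCylinder : Cylinder U where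
  I := Over.mk (P.π ≫ eU.inv ≫ U.hom)
  i₀ := Over.homMk (eU.hom ≫ P.i₀)
  i₁ := Over.homMk (eU.hom ≫ P.i₁)
  π := Over.homMk (P.π ≫ eU.inv)
  i₀_π := by ext; simp
  i₁_π := by ext; simp
  weakEquivalence_π := by
    rw [weakEquivalences_over_iff]
    exact inferInstanceAs (WeakEquivalence (P.π ≫ eU.inv))

variable {eU eV P Q}

theorem isGood_overCylinder
    (H : ∀ ⦃E B : C⦄ (p : E ⟶ B) [Fibration p] [WeakEquivalence p] (g₀ g₁ : U₀ ⟶ E) (h : P.I ⟶ B),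
      g₀ ≫ p = P.i₀ ≫ h → g₁ ≫ p = P.i₁ ≫ h →
        ∃ l, P.i₀ ≫ l = g₀ ∧ P.i₁ ≫ l = g₁ ∧ l ≫ p = h) :
    (overCylinder eU P).IsGood :=
  isGood_of_exists_lift fun E B p _ _ g₀ g₁ h h₀ h₁ => by
    change g₀ ≫ p = (eU.hom ≫ P.i₀) ≫ h at h₀
    change g₁ ≫ p = (eU.hom ≫ P.i₁) ≫ h at h₁
    change ∃ l, (eU.hom ≫ P.i₀) ≫ l = g₀ ∧ (eU.hom ≫ P.i₁) ≫ l = g₁ ∧ l ≫ p = h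
    obtain ⟨l, l₀, l₁, hl⟩ := H p (eU.inv ≫ g₀) (eU.inv ≫ g₁) h
      (by rw [Category.assoc, h₀, Category.assoc, eU.inv_hom_id_assoc])
      (by rw [Category.assoc, h₁, Category.assoc, eU.inv_hom_id_assoc])
    exact ⟨l, by rw [Category.assoc, l₀, eU.hom_inv_id_assoc],
      by rw [Category.assoc, l₁, eU.hom_inv_id_assoc], hl⟩

/-- A map of cylinders in `C` induces a map of cylinders in slice categories. -/
noncomputable abbrev overCylinderMap (he : i.left ≫ eV.hom = eU.hom ≫ i₀) (k : P.I ⟶ Q.I)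
    (k₀ : P.i₀ ≫ k = i₀ ≫ Q.i₀) (k₁ : P.i₁ ≫ k = i₀ ≫ Q.i₁) (kπ : k ≫ Q.π = P.π ≫ i₀) :
    CylinderMap i (overCylinder eU P) (overCylinder eV Q) :=
  have he' : i₀ ≫ eV.inv = eU.inv ≫ i.left := by
    rw [Iso.comp_inv_eq, Category.assoc, he, Iso.inv_hom_id_assoc]
  { hom := Over.homMk k (by
      dsimp
      rw [reassoc_of% kπ, reassoc_of% he', Over.w])
    i₀_comm := by ext; simp [k₀, reassoc_of% he]
    i₁_comm := by ext; simp [k₁, reassoc_of% he]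
    π_comm := by ext; simp [reassoc_of% kπ, he'] }

theorem hasLiftingProperty_overCylinderMap_cornerMap {he : i.left ≫ eV.hom = eU.hom ≫ i₀}
    {k : P.I ⟶ Q.I} {k₀ : P.i₀ ≫ k = i₀ ≫ Q.i₀} {k₁ : P.i₁ ≫ k = i₀ ≫ Q.i₁}
    {kπ : k ≫ Q.π = P.π ≫ i₀} (E : Over Γ)
    (H : ∀ (f : P.I ⟶ E.left) (g₀ g₁ : V₀ ⟶ E.left) (h : Q.I ⟶ Γ),
      P.i₀ ≫ f = i₀ ≫ g₀ → P.i₁ ≫ f = i₀ ≫ g₁ → f ≫ E.hom = k ≫ h →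
      g₀ ≫ E.hom = Q.i₀ ≫ h → g₁ ≫ E.hom = Q.i₁ ≫ h →
        ∃ l, k ≫ l = f ∧ Q.i₀ ≫ l = g₀ ∧ Q.i₁ ≫ l = g₁ ∧ l ≫ E.hom = h) :
    HasLiftingProperty (overCylinderMap he k k₀ k₁ kπ).cornerMap (terminal.from E) := by
  refine CylinderMap.hasLiftingProperty_cornerMap _ _ fun f g₀ g₁ f₀ f₁ hf h₀ h₁ => ?_
  change (eU.hom ≫ P.i₀) ≫ f = i.left ≫ g₀ at f₀
  change (eU.hom ≫ P.i₁) ≫ f = i.left ≫ g₁ at f₁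
  change g₀ ≫ E.hom = (eV.hom ≫ Q.i₀) ≫ Q.π ≫ eV.inv ≫ V.hom at h₀
  change g₁ ≫ E.hom = (eV.hom ≫ Q.i₁) ≫ Q.π ≫ eV.inv ≫ V.hom at h₁
  change ∃ l, k ≫ l = f ∧ (eV.hom ≫ Q.i₀) ≫ l = g₀ ∧ (eV.hom ≫ Q.i₁) ≫ l = g₁ ∧
    l ≫ E.hom = Q.π ≫ eV.inv ≫ V.hom
  -- The base map is the structure map of the cylinder over `Γ`.
  obtain ⟨l, hl, l₀, l₁, hE⟩ := H f (eV.inv ≫ g₀) (eV.inv ≫ g₁) (Q.π ≫ eV.inv ≫ V.hom)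
    (by
      rw [← cancel_epi eU.hom, ← Category.assoc, f₀, ← reassoc_of% he, eV.hom_inv_id_assoc])
    (by
      rw [← cancel_epi eU.hom, ← Category.assoc, f₁, ← reassoc_of% he, eV.hom_inv_id_assoc])
    hf
    (by rw [Category.assoc, h₀, Category.assoc, eV.inv_hom_id_assoc])
    (by rw [Category.assoc, h₁, Category.assoc, eV.inv_hom_id_assoc])
  exact ⟨l, hl, by rw [Category.assoc, l₀, eV.hom_inv_id_assoc],
    by rw [Category.assoc, l₁, eV.hom_inv_id_assoc], hE⟩

end

end OverCylinders

/-! ### Proof for classes of horns -/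

section Horns

open MonoidalCategory SSet

variable {C : Type u} [Category.{v} C] [ModelCategory C]

theorem IsReedyCofibrant.isCofibrant_tensorObj {X : SimplexCategory ⥤ C} (hX : IsReedyCofibrant X)
    (K : SSet.{v}) [K.Finite] [K.Nonsingular] : IsCofibrant (tensorObj X K) := by
  rw [isCofibrant_iff, cofibration_iff, ← trivialFibrations_llp]
  intro E B p hp
  rw [mem_trivialFibrations_iff] at hp
  have := hp.1
  have := hp.2
  refine ⟨fun {g b} sq => ?_⟩
  -- Lifting from the initial object of `C` corresponds to extending along `∅ ⊆ K`.
  have := hX.rlp_monomorphisms_homSSetMap p ((⊥ : K.Subcomplex).ι) (.infer_property _)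
  have sq' : CommSq (Subcomplex.isInitialBot.to (homSSet X E)) (⊥ : K.Subcomplex).ι
    (homSSetMap X p) (tensorEquiv X K B b) := ⟨Subcomplex.isInitialBot.hom_ext _ _⟩
  obtain ⟨⟨l, -, hl⟩⟩ := (this.sq_hasLift sq').exists_lift
  exact ⟨⟨⟨(tensorEquiv X K E).symm l, initial.hom_ext _ _, by
    rw [tensorEquiv_symm_comp, hl, Equiv.symm_apply_apply]⟩⟩⟩

/-- The source is a cobase change of the latching cofibration of `X`, starting from the cofibrant
object `Y ⊗ ∂Δ[n]`. -/
theorem CofibrantCosimplicialResolution.isCofibrant_source {A B : C} {f : A ⟶ B}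
    (r : CofibrantCosimplicialResolution f) (n : ℕ) :
    IsCofibrant (cornerObj r.hom (bdryι n)) := by
  have := r.source.isReedyCofibrant.cofibration_mapRight_bdryι n
  have : IsCofibrant (tensorObj r.target.obj (bdry n)) :=
    r.target.isReedyCofibrant.isCofibrant_tensorObj _
  exact isCofibrant_of_cofibration
    (pushout.inr (tensorMapRight r.source.obj (bdryι n)) (tensorMapLeft r.hom (bdry n)))

theorem IsClassOfHorns.isClosedUnderCoidentityTypes {S Λ : MorphismProperty C}
    (hΛ : IsClassOfHorns S Λ) : IsClosedUnderCoidentityTypes Λ := by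
  obtain ⟨R, -, hΛ⟩ := hΛ
  intro Γ U V i hi
  obtain ⟨A, B, f, hf, r, hr, n, ⟨e⟩⟩ := (hΛ i.left).1 hi
  have hX := r.source.isReedyCofibrant
  have hX' := r.source.isHomotopicallyConstant
  have hY := r.target.isReedyCofibrant
  have hY' := r.target.isHomotopicallyConstant
  have := weakEquivalence_cornerPrecylinder_π (φ := r.hom) (A := ∂Δ[n]) hX hX' hY hY'
  have := weakEquivalence_tensorPrecylinder_π (L := Δ[n]) hY hY'
  let eU : U.left ≅ cornerObj r.hom (bdryι n) := Arrow.leftFunc.mapIso e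
  let eV : V.left ≅ tensorObj r.target.obj Δ[n] := Arrow.rightFunc.mapIso e
  have he : i.left ≫ eV.hom = eU.hom ≫ hornMap r.hom n := e.hom.w.symm
  refine ⟨overCylinder eU (cornerPrecylinder r.hom ∂Δ[n]),
    overCylinder eV (tensorPrecylinder r.target.obj Δ[n]),
    overCylinderMap he (cornerTo r.hom (∂Δ[n].ι ▷ Δ[1]))
      (cornerPrecylinder_i₀_cornerTo _ _) (cornerPrecylinder_i₁_cornerTo _ _)
      (cornerTo_tensorPrecylinder_π _ _),
    isGood_overCylinder fun _ _ p _ _ _ _ _ h₀ h₁ => exists_lift_cornerPrecylinder hX hY p h₀ h₁,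
    isGood_overCylinder fun _ _ p _ _ _ _ _ h₀ h₁ => exists_lift_tensorPrecylinder hY p h₀ h₁,
    fun E _ hE => hasLiftingProperty_overCylinderMap_cornerMap E
      fun _ _ _ _ f₀ f₁ hf' h₀ h₁ => exists_lift_cornerTo E.hom
        -- All the horns of the resolution `r` belong to `Λ`, not only the one in dimension `n`;
        -- this is what makes `homCorner` lift against every monomorphism.
        (fun m => hE _ ((hΛ _).2 ⟨A, B, f, hf, r, hr, m, ⟨Iso.refl _⟩⟩)) f₀ f₁ hf' h₀ h₁⟩

theorem IsClassOfHorns.cofibration_and_isCofibrant {S Λ : MorphismProperty C}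
    (hΛ : IsClassOfHorns S Λ) {A B : C} {i : A ⟶ B} (hi : Λ i) :
    Cofibration i ∧ IsCofibrant A ∧ IsCofibrant B := by
  obtain ⟨R, -, hΛ⟩ := hΛ
  obtain ⟨A', B', f, hf, r, hr, n, ⟨e⟩⟩ := (hΛ i).1 hi
  have := r.isReedyCofibration.cofibration_hornMap n
  have hi : Cofibration i := by
    rw [cofibration_iff] at this ⊢
    exact ((cofibrations C).arrow_mk_iso_iff e).2 this
  have := r.isCofibrant_source n
  let eA : cornerObj r.hom (bdryι n) ≅ A := (Arrow.leftFunc.mapIso e).symm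
  have : IsCofibrant A := isCofibrant_of_cofibration eA.hom
  exact ⟨hi, this, isCofibrant_of_cofibration i⟩

end Horns
end CosimplicialResolutions

theorem mainTheorem9 {C : Type u} [Category.{v} C] [ModelCategory C]
    (S Λ : MorphismProperty C) (hΛ : CosimplicialResolutions.IsClassOfHorns S Λ) :
    CosimplicialResolutions.IsClosedUnderCoidentityTypes Λ ∧
      ∀ ⦃A B : C⦄ (i : A ⟶ B), Λ i → Cofibration i ∧ IsCofibrant A ∧ IsCofibrant B :=
  ⟨hΛ.isClosedUnderCoidentityTypes, fun _ _ _ => hΛ.cofibration_and_isCofibrant⟩
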